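/- Let $f:S^n\to S^m$ be a smooth map between unit spheres and let $\theta\in(0,\pi/2)$ be such that $M_{f,\theta}=\{(\cos\theta\, x,\ \sin\theta\, f(x)) : x\in S^n\}$ is a minimal submanifold of $S^{m+n+1}$. Assume that $f$ is an LOMSE of $(n,p,k)$-type with nonzero singular value $\lambda>0$: $0<p<n$, at every $x\in S^n$ the differential $df_x:T_xS^n\to T_{f(x)}S^m$ has the singular values $\lambda$ (with multiplicity $p$) and $0$ (with multiplicity $n-p$), and all components of $f$ are spherical harmonics of degree $k$. Assume that $f$ is of Type (I), that is, $(n,p,k)\in\{(3,2,2),(5,4,2),(5,4,4)\}$ or $n\ge 7$. Equip the right half $r\rho$-plane with the canonical metric $$g_0=\sigma_0^2\,(r^2+\lambda^2\rho^2)^p\, r^{2(n-p)}\,(dr^2+d\rho^2),$$ where $\sigma_0$ is the volume of the unit sphere $S^n$. Then there is a number $\varphi_1>\varphi_0:=\tan\theta$ such that the LOC ray $\{\rho=\varphi_0 r\}$ is length-minimizing for $g_0$ in the closed angular sector $$\mathscr S=\{(r,\rho): r\ge 0,\ 0\le\rho\le\varphi_1 r\}$$ between $\{\rho=0\}$ and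 $\{\rho=\varphi_1 r\}$: for all $0\le s\le t$, the arc of the ray from $(s,\varphi_0 s)$ to $(t,\varphi_0 t)$ has the least $g_0$-length among all absolutely continuous curves in $\mathscr S$ with the same endpoints. -/

import Mathlib

open scoped Manifold ContDiff InnerProductSpace
open MeasureTheory

noncomputable section

namespace LawsonOsserman

/-- Euclidean space of dimension `d`. -/
abbrev Euc (d : ℕ) : Type := EuclideanSpace ℝ (Fin d)

/-- The unit sphere `S^n` of dimension `n`. -/
abbrev Sph (n : ℕ) : Type := Metric.sphere (0 : Euc (n + 1)) 1

/-! ### Differential calculus on the unit sphere -/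

section Calculus

variable {n : ℕ} {V : Type*} [NormedAddCommGroup V]

/-- The extension `y ↦ h (y / |y|)` of a map on `S^n`, constant along rays (with value `0` at the
origin, which plays no role). -/
def radialExt (h : Sph n → V) (y : Euc (n + 1)) : V :=
  open Classical in
  if hy : y = 0 then 0
  else h ⟨‖y‖⁻¹ • y, by
    rw [mem_sphere_zero_iff_norm, norm_smul, norm_inv, norm_norm,
      inv_mul_cancel₀ (norm_ne_zero_iff.mpr hy)]⟩

/-- The tangent space `T_x S^n`, the orthogonal complement of `x`. -/
def tangent (x : Sph n) : Submodule ℝ (Euc (n + 1)) :=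
  (Submodule.span ℝ {(x : Euc (n + 1))})ᗮ

variable [NormedSpace ℝ V]

/-- The differential of `h` at `x ∈ S^n`: on tangent vectors at `x` it is the usual differential,
and it vanishes on the normal vector `x`. -/
def sphereDeriv (h : Sph n → V) (x : Sph n) : Euc (n + 1) →L[ℝ] V :=
  fderiv ℝ (radialExt h) (x : Euc (n + 1))

/-- The second derivative of `h` at `x ∈ S^n` along a tangent vector `v`. For a unit tangent
vector this is the acceleration at time `0` of `h` along the great circle `cos t • x + sin t • v`. -/
def sphereSecondDeriv (h : Sph n → V) (x : Sph n) (v : Euc (n + 1)) : V :=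
  iteratedFDeriv ℝ 2 (radialExt h) (x : Euc (n + 1)) (fun _ => v)

end Calculus

/-- `X` is a smooth immersion of `S^n` as a minimal submanifold of the unit sphere of `V`: for every
basis `e` of `T_x S^n` that is orthonormal for the induced metric, the trace
`∑ i, D²X (e i, e i)` has no component orthogonal to the position vector `X x` and to the tangent
space `dX (T_x S^n)`, i.e. the mean curvature vector in the unit sphere vanishes. -/
structure IsMinimalInSphere {n : ℕ} {V : Type*} [NormedAddCommGroup V] [InnerProductSpace ℝ V]
    (X : Sph n → V) : Prop where
  smooth : ContMDiff (𝓡 n) 𝓘(ℝ, V) ∞ X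
  norm_eq_one : ∀ x, ‖X x‖ = 1
  immersion : ∀ x, ∀ v ∈ tangent x, sphereDeriv X x v = 0 → v = 0
  mean_curvature_eq_zero : ∀ x, ∀ e : Fin n → Euc (n + 1), (∀ i, e i ∈ tangent x) →
    (∀ i j, ⟪sphereDeriv X x (e i), sphereDeriv X x (e j)⟫_ℝ = if i = j then 1 else 0) →
    ∑ i, sphereSecondDeriv X x (e i) ∈
      Submodule.span ℝ {X x} ⊔ (tangent x).map (sphereDeriv X x).toLinearMap

/-! ### Lawson-Osserman maps -/

/-- The map `x ↦ (cos θ · x, sin θ · f x)` parametrizing `M_{f,θ}`. -/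
def losMap {n m : ℕ} (f : Sph n → Sph m) (θ : ℝ) (x : Sph n) :
    WithLp 2 (Euc (n + 1) × Euc (m + 1)) :=
  WithLp.toLp 2 (Real.cos θ • (x : Euc (n + 1)), Real.sin θ • (f x : Euc (m + 1)))

/-- `f` is a Lawson-Osserman map with acute angle `θ`. -/
structure IsLOM {n m : ℕ} (f : Sph n → Sph m) (θ : ℝ) : Prop where
  smooth : ContMDiff (𝓡 n) (𝓡 m) ∞ f
  angle_pos : 0 < θ
  angle_lt : θ < Real.pi / 2
  minimal : IsMinimalInSphere (losMap f θ)

/-- At every point the differential of `f` has the singular values `lam > 0`, with multiplicity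
`p`, and `0`, with multiplicity `n - p`, and both do occur: there is a `p`-dimensional subspace of
the tangent space on which `df` multiplies lengths by `lam`, and `df` vanishes on its orthogonal
complement in the tangent space. -/
structure HasSingularValues {n m : ℕ} (f : Sph n → Sph m) (p : ℕ) (lam : ℝ) : Prop where
  mult_pos : 0 < p
  mult_lt : p < n
  lam_pos : 0 < lam
  exists_horizontal : ∀ x, ∃ H : Submodule ℝ (Euc (n + 1)), H ≤ tangent x ∧
    Module.finrank ℝ H = p ∧
    (∀ v ∈ H, ‖sphereDeriv (fun y => (f y : Euc (m + 1))) x v‖ = lam * ‖v‖) ∧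
    ∀ v ∈ tangent x ⊓ Hᗮ, sphereDeriv (fun y => (f y : Euc (m + 1))) x v = 0

/-- All components of `f` are spherical harmonics of degree `k`, i.e. restrictions to `S^n` of
harmonic homogeneous polynomials of degree `k`. -/
def HasHarmonicDegree {n m : ℕ} (f : Sph n → Sph m) (k : ℕ) : Prop :=
  ∀ j : Fin (m + 1), ∃ P : MvPolynomial (Fin (n + 1)) ℝ, P.IsHomogeneous k ∧
    ∑ i, MvPolynomial.pderiv i (MvPolynomial.pderiv i P) = 0 ∧
    ∀ x : Sph n, (f x : Euc (m + 1)) j = MvPolynomial.eval (fun i => (x : Euc (n + 1)) i) P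

/-- `f` is an LOMSE of `(n,p,k)`-type, with angle `θ` and nonzero singular value `lam`. -/
structure IsLOMSE {n m : ℕ} (f : Sph n → Sph m) (θ : ℝ) (p k : ℕ) (lam : ℝ) : Prop where
  lom : IsLOM f θ
  singular_values : HasSingularValues f p lam
  degree : HasHarmonicDegree f k

/-- Type (I). -/
def IsTypeI (n p k : ℕ) : Prop :=
  (n, p, k) = (3, 2, 2) ∨ (n, p, k) = (5, 4, 2) ∨ (n, p, k) = (5, 4, 4) ∨ 7 ≤ n

/-! ### The quotient half plane with its canonical metric -/

/-- The volume of the unit sphere `S^n`. -/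
def sphereVolume (n : ℕ) : ℝ :=
  ((volume : Measure (Euc (n + 1))).toSphere).real Set.univ

/-- The conformal factor of the canonical metric `g₀ = canonicalFactor · (dr² + dρ²)`, for `p ≤ n`. -/
def canonicalFactor (n p : ℕ) (lam r ρ : ℝ) : ℝ :=
  sphereVolume n ^ 2 * ((r ^ 2 + lam ^ 2 * ρ ^ 2) ^ p * r ^ (2 * (n - p)))

/-- The length of the curve `t ↦ (r t, ρ t)`, `a ≤ t ≤ b`, in the canonical metric. -/
def canonicalLength (n p : ℕ) (lam : ℝ) (r ρ : ℝ → ℝ) (a b : ℝ) : ENNReal :=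
  ∫⁻ t in Set.Icc a b, ENNReal.ofReal
    (Real.sqrt (canonicalFactor n p lam (r t) (ρ t) * (deriv r t ^ 2 + deriv ρ t ^ 2)))

/-- The closed angular sector between `{ρ = 0}` and `{ρ = φ r}`, with its vertex. -/
def sector (φ : ℝ) : Set (ℝ × ℝ) :=
  {q | 0 ≤ q.1 ∧ 0 ≤ q.2 ∧ q.2 ≤ φ * q.1}

/-- `t ↦ (r t, ρ t)`, `a ≤ t ≤ b`, is an absolutely continuous curve in `S` from `P` to `Q`. -/
structure IsCurveIn (S : Set (ℝ × ℝ)) (P Q : ℝ × ℝ) (r ρ : ℝ → ℝ) (a b : ℝ) : Prop where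
  le : a ≤ b
  ac_fst : AbsolutelyContinuousOnInterval r a b
  ac_snd : AbsolutelyContinuousOnInterval ρ a b
  mem : ∀ t ∈ Set.Icc a b, (r t, ρ t) ∈ S
  source : (r a, ρ a) = P
  target : (r b, ρ b) = Q

/-- The set of canonical lengths of the curves in `S` from `P` to `Q`. -/
def lengthsIn (n p : ℕ) (lam : ℝ) (S : Set (ℝ × ℝ)) (P Q : ℝ × ℝ) : Set ENNReal :=
  {L | ∃ (r ρ : ℝ → ℝ) (a b : ℝ), IsCurveIn S P Q r ρ a b ∧ L = canonicalLength n p lam r ρ a b}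

/-- The ray `{ρ = c r}`, parametrized by `r ≥ 0`, lies in `S` and is length-minimizing there:
each of its arcs is a shortest curve among all curves in `S` with the same endpoints. -/
def IsMinimizingRayIn (n p : ℕ) (lam : ℝ) (S : Set (ℝ × ℝ)) (c : ℝ) : Prop :=
  ∀ s t : ℝ, 0 ≤ s → s ≤ t →
    IsLeast (lengthsIn n p lam S (s, c * s) (t, c * t))
      (canonicalLength n p lam (fun r => r) (fun r => c * r) s t)

end LawsonOsserman

end

noncomputable section

namespace LawsonOsserman

/-! ### A polynomial inequality -/

/-! The proof is a calibration argument. Put `C = lam ^ 2`, `q = n - p`, `φ = ρ / r`, `y = φ ^ 2`,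
and let `R` be the Euclidean distance to the vertex. Up to the factor `sphereVolume n`, the density
of the metric is `R ^ n * w`, where `w ^ 2 = (1 + C * y) ^ p / (1 + y) ^ n` depends only on the
slope. A function `F` on the sector with `|∇F| ≤ R ^ n * w` bounds every length from below by the
increment of `F`, and a ray on which `F` grows at the full rate is therefore shortest.

The choice is `F = R ^ (n + 1) / (n + 1) * w ^ c / w₀ ^ (c - 1)`, with `w₀` the value of `w` on the
LOC ray and `c > 1` a parameter. The logarithmic derivative of `w` in the polar angle is `φ *
slopeFactor`, so `|∇F| ^ 2 / (R ^ n * w) ^ 2` is the exponential of `logRatio` minus its value on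
the ray. The derivative of `logRatio` is `slopeFactor` times a positive quantity times
`barrierCubic`. Where the cubic is nonnegative, `logRatio` thus peaks at the zero of `slopeFactor`,
which is `q * C * y = p * C - n` (`logRatio_le`). Type (I) provides a `c` for which the cubic is
nonnegative up to a slope beyond this zero (`exists_barrierCubic_nonneg`).

Geometry enters through two identities. Taking the Laplacian of `|f| ^ 2 = 1` gives `p * C = k * (k
+ n - 1)` (`singularValue_relation`). One scalar component of the minimal surface equation gives `q
* C * tan θ ^ 2 = p * C - n` (`tan_relation`), which places the LOC ray exactly at the maximum of
`w`. -/

/-- The cubic polynomial whose sign governs the calibration inequality. -/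
def barrierCubic (n p q a c x : ℝ) : ℝ :=
  (a + n + p * x) * (a - (a + 3 * q) * x - q * x ^ 2) + (c - 1) * p * x * (a - q * x) ^ 2 +
    (c - 1) * (n + 1) ^ 2 / c ^ 2 * (a + n) * (1 + x) ^ 2

lemma quadratic_form_nonneg {A B D s t : ℝ} (hA : 0 < A) (hD : 0 ≤ D) (hs : 0 ≤ s) (ht : 0 ≤ t)
    (h : 0 < B → B ^ 2 ≤ 4 * A * D) : 0 ≤ A * s ^ 2 - B * s * t + D * t ^ 2 := by
  rcases le_or_gt B 0 with hB | hB
  · have h1 : 0 ≤ -B * (s * t) := mul_nonneg (by linarith) (mul_nonneg hs ht)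
    have h2 : 0 ≤ A * s ^ 2 := by positivity
    have h3 : 0 ≤ D * t ^ 2 := by positivity
    linarith
  · have h1 : 0 ≤ (4 * A * D - B ^ 2) * t ^ 2 :=
      mul_nonneg (by linarith [h hB]) (sq_nonneg t)
    have h2 : 4 * A * (A * s ^ 2 - B * s * t + D * t ^ 2)
        = (2 * A * s - B * t) ^ 2 + (4 * A * D - B ^ 2) * t ^ 2 := by ring
    have h3 : 0 ≤ 4 * A * (A * s ^ 2 - B * s * t + D * t ^ 2) := by
      rw [h2]; positivity
    exact nonneg_of_mul_nonneg_right h3 (by linarith)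

/-- With `m = p * q`, the right side is `4 * A * D` for the quadratic form used in
`barrierCubic_nonneg_of_seven_le`. -/
lemma barrier_discriminant {n : ℕ} (hn : 7 ≤ n) {m : ℝ} (hm : (n : ℝ) - 1 ≤ m)
    (hB : 0 < n + 3 * m - 6 / 25 * ((n : ℝ) + 1) ^ 2) :
    (n + 3 * m - 6 / 25 * ((n : ℝ) + 1) ^ 2) ^ 2 ≤ m * (9 * m - 6 * n + 4) := by
  rcases lt_or_ge n 10 with h | h
  -- The uniform argument below needs `6 * n - 4 ≤ 3 * d`, which fails for `n = 7, 8, 9`.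
  · interval_cases n <;> norm_num at * <;> nlinarith
  · have hn' : (10 : ℝ) ≤ n := by exact_mod_cast h
    set d : ℝ := 6 / 25 * ((n : ℝ) + 1) ^ 2 - n with hd
    have hd1 : 6 * n - 4 ≤ 3 * d := by rw [hd]; nlinarith
    have hd0 : 0 < d := by linarith
    have h1 : d * d ≤ 3 * m * d := mul_le_mul_of_nonneg_right (by linarith) hd0.le
    have h2 : 0 ≤ m * (3 * d - (6 * n - 4)) := mul_nonneg (by linarith) (by linarith)
    have e : n + 3 * m - 6 / 25 * ((n : ℝ) + 1) ^ 2 = 3 * m - d := by rw [hd]; ring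
    rw [e]
    nlinarith

/-- For `c = 5 / 2` the constant `(c - 1) * (n + 1) ^ 2 / c ^ 2` is `K = 6 / 25 * (n + 1) ^ 2`, and
the `x ^ 3` coefficient `p * q * ((c - 1) * q - 1)` is positive even for `q = 1`. The only terms of
uncertain sign form `x` times a quadratic form in `(a, x)`, settled by its discriminant; `K`
dominates the rest. -/
lemma barrierCubic_nonneg_of_seven_le {n p q : ℕ} (hn : 7 ≤ n) (hp : 0 < p) (hq : 0 < q)
    (hpq : p + q = n) {a x : ℝ} (ha : 0 ≤ a) (hx : 0 ≤ x) :
    0 ≤ barrierCubic n p q a (5 / 2) x := by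
  have hn' : (7 : ℝ) ≤ n := by exact_mod_cast hn
  have hp' : (1 : ℝ) ≤ p := by exact_mod_cast hp
  have hq' : (1 : ℝ) ≤ q := by exact_mod_cast hq
  have hpq' : (p : ℝ) + q = n := by exact_mod_cast hpq
  -- This is `(p - 1) * (q - 1) ≥ 0`.
  have hm : (n : ℝ) - 1 ≤ p * q := by nlinarith
  have hK := barrier_discriminant hn hm
  obtain ⟨K, hKdef⟩ : ∃ K : ℝ, K = 6 / 25 * ((n : ℝ) + 1) ^ 2 := ⟨_, rfl⟩
  rw [← hKdef] at hK
  have hK1 : 0 ≤ 2 * K - n - 3 * q + p := by rw [hKdef]; nlinarith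
  have hK2 : 0 ≤ 2 * K - 3 * q := by linarith
  have hK3 : 0 ≤ K * n - n * q - 3 * (p * q) := by
    have h1 : (4 : ℝ) * (p * q) ≤ n ^ 2 := by nlinarith [sq_nonneg ((p : ℝ) - q)]
    have h2 : (n : ℝ) * q ≤ n ^ 2 := by nlinarith
    have h3 : 7 / 4 * (n : ℝ) ≤ K := by rw [hKdef]; nlinarith
    nlinarith
  have hQ := quadratic_form_nonneg (A := 3 / 2 * p - 1) (B := n + 3 * (p * q) - K)
    (D := p * q * (3 / 2 * q - 1)) (s := a) (t := x) (by linarith)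
    (mul_nonneg (by positivity) (by linarith)) ha hx
    (fun h => (hK h).trans_eq (by rw [← hpq']; ring))
  have hK0 : 0 ≤ K := by rw [hKdef]; positivity
  have e : barrierCubic n p q a (5 / 2) x = (a + n) * (a + K)
      + x * ((3 / 2 * p - 1) * a ^ 2 - (n + 3 * (p * q) - K) * a * x
        + p * q * (3 / 2 * q - 1) * x ^ 2)
      + x * (a * (2 * K - n - 3 * q + p)) + x * (n * (2 * K - 3 * q))
      + x ^ 2 * (K * n - n * q - 3 * (p * q)) := by
    rw [barrierCubic, hKdef, ← hpq']; ring
  rw [e]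
  positivity

/-- In the three exceptional cases `q = 1`, and `c = 2` cancels the `x ^ 3` term. What remains is
`72 + 60 x - 12 x²`, `192 + 320 x` and `1152 + 2640 x - 80 x²` respectively. The first turns
negative beyond `x = 6`, hence a range only slightly larger than the critical `x = a / q = 5`. -/
lemma exists_barrierCubic_nonneg {n p q k : ℕ} (hp : 0 < p) (hq : 0 < q) (hpq : p + q = n)
    (hI : IsTypeI n p k) {a : ℝ} (ha : a = ((k : ℝ) - 1) * (k + n)) (ha0 : 0 < a) :
    ∃ c : ℝ, 1 < c ∧ ∀ x, 0 ≤ x → x * q ≤ 441 / 400 * a → 0 ≤ barrierCubic n p q a c x := by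
  rcases hI with h | h | h | h
  · obtain ⟨rfl, rfl, rfl⟩ : n = 3 ∧ p = 2 ∧ k = 2 := by simpa using h
    obtain rfl : q = 1 := by omega
    refine ⟨2, by norm_num, fun x hx hx' => ?_⟩
    norm_num at ha
    subst ha
    norm_num at hx'
    norm_num [barrierCubic]
    nlinarith
  · obtain ⟨rfl, rfl, rfl⟩ : n = 5 ∧ p = 4 ∧ k = 2 := by simpa using h
    obtain rfl : q = 1 := by omega
    refine ⟨2, by norm_num, fun x hx hx' => ?_⟩
    norm_num at ha
    subst ha
    norm_num at hx'
    norm_num [barrierCubic]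
    nlinarith
  · obtain ⟨rfl, rfl, rfl⟩ : n = 5 ∧ p = 4 ∧ k = 4 := by simpa using h
    obtain rfl : q = 1 := by omega
    refine ⟨2, by norm_num, fun x hx hx' => ?_⟩
    norm_num at ha
    subst ha
    norm_num at hx'
    norm_num [barrierCubic]
    nlinarith
  · exact ⟨5 / 2, by norm_num, fun x hx _ =>
      barrierCubic_nonneg_of_seven_le h hp hq hpq ha0.le hx⟩

/-! ### The angular part of the calibration -/

/-- Twice the logarithm of the angular part of the density of the canonical metric, as a function
of the square of the slope. -/
def logDensity (n p C y : ℝ) : ℝ := p * Real.log (1 + C * y) - n * Real.log (1 + y)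

/-- The product of `1 + y` and the derivative of `logDensity` at `y`. -/
def slopeFactor (q a C y : ℝ) : ℝ := (a - q * C * y) / (1 + C * y)

lemma hasDerivAt_logDensity {n p q a C y : ℝ} (hC : 0 ≤ C) (hy : 0 ≤ y) (hpq : p + q = n)
    (ha : a = p * C - n) :
    HasDerivAt (logDensity n p C) (slopeFactor q a C y / (1 + y)) y := by
  have h1 : 0 < 1 + C * y := by positivity
  have h2 : 0 < 1 + y := by positivity
  have d1 : HasDerivAt (fun y => 1 + C * y) C y := by
    simpa using ((hasDerivAt_id y).const_mul C).const_add 1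
  have d2 : HasDerivAt (fun y => 1 + y) 1 y := (hasDerivAt_id y).const_add 1
  convert! ((d1.log h1.ne').const_mul p).sub ((d2.log h2.ne').const_mul n) using 1
  rw [slopeFactor, ha, ← hpq]
  field_simp
  ring

lemma hasDerivAt_slopeFactor {q a C y : ℝ} (hC : 0 ≤ C) (hy : 0 ≤ y) :
    HasDerivAt (slopeFactor q a C) (-(C * (q + a)) / (1 + C * y) ^ 2) y := by
  have h1 : 0 < 1 + C * y := by positivity
  have d1 : HasDerivAt (fun y => 1 + C * y) C y := by
    simpa using ((hasDerivAt_id y).const_mul C).const_add 1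
  have d2 : HasDerivAt (fun y => a - q * C * y) (-(q * C)) y := by
    simpa using ((hasDerivAt_id y).const_mul (q * C)).const_sub a
  convert! d2.div d1 h1.ne' using 1
  congr 1
  ring

/-- The logarithm of the quotient of the squared gradient of the calibration by the density. -/
def logRatio (n p q a C c y : ℝ) : ℝ :=
  (c - 1) * logDensity n p C y +
    Real.log (1 + c ^ 2 / (n + 1) ^ 2 * (y * slopeFactor q a C y ^ 2))

/-- The last factor on the right is what differentiating `logRatio` leaves after removal of
`slopeFactor` and positive factors. Since `a + n = p * C`, clearing denominators produces a
polynomial in `x = C * y` alone, with `(a + n) * (1 + y) = a + n + p * x`. -/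
lemma barrierCubic_mul_eq {n p q a C c y : ℝ} (hC : 0 < C) (hy : 0 ≤ y)
    (ha : a = p * C - n) :
    barrierCubic n p q a c (C * y) = (a + n) * (1 + C * y) ^ 2 *
      ((c - 1) * (n + 1) ^ 2 / c ^ 2 + (c - 1) * (y * slopeFactor q a C y ^ 2) +
        (1 + y) * (slopeFactor q a C y + 2 * y * (-(C * (q + a)) / (1 + C * y) ^ 2))) := by
  have h1 : 0 < 1 + C * y := by positivity
  have e1 : slopeFactor q a C y * (1 + C * y) = a - q * C * y := by
    rw [slopeFactor]; field_simp
  have e2 : -(C * (q + a)) / (1 + C * y) ^ 2 * (1 + C * y) ^ 2 = -(C * (q + a)) := by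
    field_simp
  have e3 : a + n = p * C := by rw [ha]; ring
  calc _ = (a + n) * ((c - 1) * (n + 1) ^ 2 / c ^ 2 * (1 + C * y) ^ 2 +
        (c - 1) * (y * (slopeFactor q a C y * (1 + C * y)) ^ 2) +
        (1 + y) * ((slopeFactor q a C y * (1 + C * y)) * (1 + C * y) +
          2 * y * (-(C * (q + a)) / (1 + C * y) ^ 2 * (1 + C * y) ^ 2))) := by
        rw [e1, e2, barrierCubic, e3]; ring
    _ = _ := by ring

lemma hasDerivAt_logRatio {n p q a C c y : ℝ} (hn : 0 ≤ n) (hC : 0 < C) (hc : 0 < c) (hy : 0 ≤ y)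
    (hpq : p + q = n) (ha : a = p * C - n) (hpos : 0 < a + n) :
    HasDerivAt (logRatio n p q a C c)
      (slopeFactor q a C y * (c ^ 2 * barrierCubic n p q a c (C * y) /
        ((n + 1) ^ 2 * (1 + y) * (1 + c ^ 2 / (n + 1) ^ 2 * (y * slopeFactor q a C y ^ 2)) *
          ((a + n) * (1 + C * y) ^ 2)))) y := by
  have h1 : 0 < 1 + C * y := by positivity
  have h2 : 0 < 1 + y := by positivity
  have h3 : 0 < 1 + c ^ 2 / (n + 1) ^ 2 * (y * slopeFactor q a C y ^ 2) := by positivity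
  have hg := hasDerivAt_slopeFactor (q := q) (a := a) hC.le hy
  have hμ := ((((hasDerivAt_id y).mul (hg.pow 2)).const_mul (c ^ 2 / (n + 1) ^ 2)).const_add 1)
  convert! ((hasDerivAt_logDensity hC.le hy hpq ha).const_mul (c - 1)).add (hμ.log h3.ne') using 1
  have e3 : 0 < (a + n) * (1 + C * y) ^ 2 := by positivity
  rw [barrierCubic_mul_eq hC hy ha]
  simp only [id, Pi.mul_apply, Pi.pow_apply]
  generalize slopeFactor q a C y = g at *
  generalize -(C * (q + a)) / (1 + C * y) ^ 2 = g' at *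
  generalize (a + n) * (1 + C * y) ^ 2 = E at *
  have h4 : (n + 1) ^ 2 + c ^ 2 * y * g ^ 2 ≠ 0 := by positivity
  have h5 : (n + 1) ^ 2 + c ^ 2 * (y * g ^ 2) ≠ 0 := by positivity
  field_simp
  ring

/-- `slopeFactor` is positive before `τ` and negative after it, so `logRatio` increases up to `τ`
and decreases afterwards; at `τ` its second summand vanishes. -/
lemma logRatio_le {n p q a C c τ τ₁ : ℝ} (hn : 0 ≤ n) (hC : 0 < C) (hc : 0 < c) (hq : 0 < q)
    (hpq : p + q = n) (ha : a = p * C - n) (hpos : 0 < a + n) (hτ : 0 ≤ τ) (hττ : q * C * τ = a) (hτ₁ : τ ≤ τ₁)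
    (hcubic : ∀ y, 0 ≤ y → y ≤ τ₁ → 0 ≤ barrierCubic n p q a c (C * y)) {y : ℝ} (hy : 0 ≤ y)
    (hy₁ : y ≤ τ₁) :
    logRatio n p q a C c y ≤ (c - 1) * logDensity n p C τ := by
  have e : logRatio n p q a C c τ = (c - 1) * logDensity n p C τ := by
    simp [logRatio, slopeFactor, hττ]
  have hd := fun z (hz : 0 ≤ z) => hasDerivAt_logRatio (n := n) (p := p) (q := q) (a := a)
    hn hC hc hz hpq ha hpos
  have hpart : ∀ z, 0 ≤ z → z ≤ τ₁ → 0 ≤ c ^ 2 * barrierCubic n p q a c (C * z) /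
      ((n + 1) ^ 2 * (1 + z) * (1 + c ^ 2 / (n + 1) ^ 2 * (z * slopeFactor q a C z ^ 2)) *
          ((a + n) * (1 + C * z) ^ 2)) := by
    intro z hz hz1
    have := hcubic z hz hz1
    positivity
  rw [← e]
  rcases le_total y τ with h | h
  · refine monotoneOn_of_deriv_nonneg (convex_Icc y τ)
      (fun z hz => (hd z (hy.trans hz.1)).continuousAt.continuousWithinAt) ?_ ?_
      (Set.left_mem_Icc.2 h) (Set.right_mem_Icc.2 h) h
    · intro z hz
      rw [interior_Icc] at hz
      exact (hd z (hy.trans hz.1.le)).differentiableAt.differentiableWithinAt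
    · intro z hz
      rw [interior_Icc] at hz
      have hz0 := hy.trans hz.1.le
      rw [(hd z hz0).deriv]
      refine mul_nonneg ?_ (hpart z hz0 (hz.2.le.trans hτ₁))
      refine div_nonneg ?_ (by positivity)
      rw [← hττ]
      nlinarith [mul_pos hq hC, hz.2]
  · refine antitoneOn_of_deriv_nonpos (convex_Icc τ y)
      (fun z hz => (hd z (hτ.trans hz.1)).continuousAt.continuousWithinAt) ?_ ?_
      (Set.left_mem_Icc.2 h) (Set.right_mem_Icc.2 h) h
    · intro z hz
      rw [interior_Icc] at hz
      exact (hd z (hτ.trans hz.1.le)).differentiableAt.differentiableWithinAt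
    · intro z hz
      rw [interior_Icc] at hz
      have hz0 := hτ.trans hz.1.le
      rw [(hd z hz0).deriv]
      refine mul_nonpos_of_nonpos_of_nonneg ?_ (hpart z hz0 (hz.2.le.trans hy₁))
      refine div_nonpos_of_nonpos_of_nonneg ?_ (by positivity)
      rw [← hττ]
      nlinarith [mul_pos hq hC, hz.1]

/-! ### Lengths of curves in a sector and calibrations -/

lemma convex_sector (φ : ℝ) : Convex ℝ (sector φ) := by
  rintro ⟨r, ρ⟩ ⟨h1, h2, h3⟩ ⟨r', ρ'⟩ ⟨h1', h2', h3'⟩ a b ha hb _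
  simp only [sector, Set.mem_ofPred_eq, Prod.smul_mk, Prod.mk_add_mk, smul_eq_mul] at *
  refine ⟨by positivity, by positivity, ?_⟩
  have := mul_le_mul_of_nonneg_left h3 ha
  have := mul_le_mul_of_nonneg_left h3' hb
  linarith

/-- The homogeneous function of degree `n + 1` on the right half plane whose restriction to
`{r = 1}` is `b`. -/
def homogeneousExt (n : ℕ) (b : ℝ → ℝ) (z : ℝ × ℝ) : ℝ := z.1 ^ (n + 1) * b (z.2 / z.1)

/-- The homogeneous extension of `b` has gradient of Euclidean length at most
`(r² + C ρ²) ^ (p / 2) r ^ q` over the slopes between `0` and `φ₁`. -/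
structure IsCalibration (n p q : ℕ) (C φ₁ : ℝ) (b b' : ℝ → ℝ) : Prop where
  add_eq : p + q = n
  hasDerivAt : ∀ φ, HasDerivAt b (b' φ) φ
  le : ∀ φ, 0 ≤ φ → φ ≤ φ₁ →
    ((n + 1) * b φ - φ * b' φ) ^ 2 + b' φ ^ 2 ≤ (1 + C * φ ^ 2) ^ p

/-- For `r > 0` the gradient is `r ^ n * ((n + 1) * b - φ * b', b')`, and Cauchy-Schwarz applies.
The derivative is taken within the sector because the extension is controlled at the vertex only
there. -/
lemma IsCalibration.exists_hasFDerivWithinAt {n p q : ℕ} {C φ₁ : ℝ} {b b' : ℝ → ℝ}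
    (h : IsCalibration n p q C φ₁ b b') (hn : 0 < n) {z : ℝ × ℝ} (hz : z ∈ sector φ₁) :
    ∃ L : ℝ × ℝ →L[ℝ] ℝ, HasFDerivWithinAt (homogeneousExt n b) L (sector φ₁) z ∧
      ∀ w, |L w| ≤ √((z.1 ^ 2 + C * z.2 ^ 2) ^ p * z.1 ^ (2 * q) * (w.1 ^ 2 + w.2 ^ 2)) := by
  obtain ⟨r, ρ⟩ := z
  obtain ⟨h1, h2, h3⟩ := hz
  simp only at h1 h2 h3
  rcases h1.eq_or_lt with h0 | h0
  · subst h0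
    obtain rfl : ρ = 0 := le_antisymm (by simpa using h3) h2
    -- At the vertex the function is `O(‖z‖ ^ (n + 1))` with `n + 1 > 1`, as the slope stays in a
    -- compact interval; so its derivative is zero.
    refine ⟨0, ?_, fun w => by simp⟩
    refine Asymptotics.IsBigO.hasFDerivWithinAt (n := n + 1) ?_ ⟨le_rfl, le_rfl, by simp⟩
      (by omega)
    have hcont : Continuous b := continuous_iff_continuousAt.2 fun φ => (h.hasDerivAt φ).continuousAt
    obtain ⟨K, hK⟩ := (isCompact_Icc (a := (0 : ℝ)) (b := max φ₁ 0)).exists_bound_of_continuousOn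
      hcont.continuousOn
    refine Asymptotics.IsBigO.of_bound K ?_
    filter_upwards [self_mem_nhdsWithin] with z hz
    obtain ⟨hz1, hz2, hz3⟩ := hz
    have hb : ‖b (z.2 / z.1)‖ ≤ K := by
      apply hK
      refine ⟨by positivity, ?_⟩
      rcases hz1.eq_or_lt with h0 | h0
      · rw [← h0]; simp
      · exact le_max_of_le_left ((div_le_iff₀ h0).2 hz3)
    have hK0 : 0 ≤ K := (norm_nonneg _).trans hb
    have hz0 : |z.1| ≤ ‖z‖ := norm_fst_le z
    rw [homogeneousExt, norm_mul, mul_comm, Prod.mk_zero_zero, sub_zero]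
    simp only [norm_pow, Real.norm_eq_abs, abs_norm] at hb ⊢
    gcongr
  · obtain ⟨φ, rfl⟩ : ∃ φ, ρ = r * φ := ⟨ρ / r, by field_simp⟩
    have hφ0 : 0 ≤ φ := nonneg_of_mul_nonneg_right h2 h0
    have hφ1 : φ ≤ φ₁ := by
      rw [mul_comm] at h3; exact le_of_mul_le_mul_right h3 h0
    refine ⟨(r ^ n * ((n + 1) * b φ - φ * b' φ)) • ContinuousLinearMap.fst ℝ ℝ ℝ +
      (r ^ n * b' φ) • ContinuousLinearMap.snd ℝ ℝ ℝ, ?_, fun w => ?_⟩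
    · refine HasFDerivAt.hasFDerivWithinAt ?_
      have d1 : HasFDerivAt (fun z : ℝ × ℝ => z.1) (ContinuousLinearMap.fst ℝ ℝ ℝ) (r, r * φ) :=
        hasFDerivAt_fst
      have d2 : HasFDerivAt (fun z : ℝ × ℝ => z.2) (ContinuousLinearMap.snd ℝ ℝ ℝ) (r, r * φ) :=
        hasFDerivAt_snd
      have d3 := d2.fun_mul ((hasDerivAt_inv h0.ne').comp_hasFDerivAt (r, r * φ) d1)
      have e : r * φ / r = φ := by field_simp
      have d4 : HasDerivAt b (b' φ) ((fun z : ℝ × ℝ => z.2 * z.1⁻¹) (r, r * φ)) := by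
        simpa only [← div_eq_mul_inv, e] using h.hasDerivAt φ
      have d5 := ((hasDerivAt_pow (n + 1) r).comp_hasFDerivAt (r, r * φ) d1).fun_mul (d4.comp_hasFDerivAt (r, r * φ) d3)
      refine d5.congr_fderiv ?_
      ext
      all_goals
        simp
        field_simp
        try ring
    · refine Real.abs_le_sqrt ?_
      have hle := h.le φ hφ0 hφ1
      have e : (r ^ 2 + C * (r * φ) ^ 2) ^ p * r ^ (2 * q) = r ^ (2 * n) * (1 + C * φ ^ 2) ^ p := by
        rw [← h.add_eq]
        have : r ^ 2 + C * (r * φ) ^ 2 = r ^ 2 * (1 + C * φ ^ 2) := by ring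
        rw [this, mul_pow]; ring
      simp only [add_apply, smul_apply,
        ContinuousLinearMap.coe_fst', ContinuousLinearMap.coe_snd', smul_eq_mul]
      rw [e]
      set A := (n + 1) * b φ - φ * b' φ
      calc (r ^ n * A * w.1 + r ^ n * b' φ * w.2) ^ 2
          = r ^ (2 * n) * (A * w.1 + b' φ * w.2) ^ 2 := by ring
        _ ≤ r ^ (2 * n) * ((A ^ 2 + b' φ ^ 2) * (w.1 ^ 2 + w.2 ^ 2)) := by
            gcongr
            nlinarith [sq_nonneg (A * w.2 - b' φ * w.1)]
        _ ≤ r ^ (2 * n) * ((1 + C * φ ^ 2) ^ p * (w.1 ^ 2 + w.2 ^ 2)) := by gcongr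
        _ = _ := by ring

/-- The gradient is bounded on the convex truncated sector. This makes the calibration absolutely
continuous along absolutely continuous curves, vertex included. -/
lemma IsCalibration.exists_lipschitz {n p q : ℕ} {C φ₁ : ℝ} {b b' : ℝ → ℝ}
    (h : IsCalibration n p q C φ₁ b b') (hn : 0 < n) (hC : 0 ≤ C) (R : ℝ) :
    ∃ K : ℝ, ∀ z ∈ sector φ₁, ∀ w ∈ sector φ₁, z.1 ≤ R → w.1 ≤ R →
      dist (homogeneousExt n b z) (homogeneousExt n b w) ≤ K * dist z w := by
  choose! L hL hbound using fun z hz => h.exists_hasFDerivWithinAt hn (z := z) hz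
  have hconv : Convex ℝ (sector φ₁ ∩ {z | z.1 ≤ R}) :=
    (convex_sector φ₁).inter (convex_halfSpace_le (ContinuousLinearMap.fst ℝ ℝ ℝ).isBoundedLinearMap.toIsLinearMap R)
  refine ⟨√((R ^ 2 + C * (|φ₁| * R) ^ 2) ^ p * R ^ (2 * q) * 2), fun z hz w hw hzR hwR => ?_⟩
  rw [dist_comm, dist_comm z w, dist_eq_norm, dist_eq_norm]
  have hR0 : 0 ≤ R := hz.1.trans hzR
  refine hconv.norm_image_sub_le_of_norm_hasFDerivWithin_le (f' := L)
    (fun x hx => (hL x hx.1).mono Set.inter_subset_left) (fun x hx => ?_) ⟨hz, hzR⟩ ⟨hw, hwR⟩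
  obtain ⟨⟨hx1, hx2, hx3⟩, hxR⟩ := hx
  refine ContinuousLinearMap.opNorm_le_bound _ (Real.sqrt_nonneg _) fun v => ?_
  refine (hbound x ⟨hx1, hx2, hx3⟩ v).trans ?_
  rw [← Real.sqrt_sq (norm_nonneg v), ← Real.sqrt_mul (by positivity)]
  refine Real.sqrt_le_sqrt ?_
  have hv1 : v.1 ^ 2 ≤ ‖v‖ ^ 2 := by rw [← sq_abs]; gcongr; exact norm_fst_le v
  have hv2 : v.2 ^ 2 ≤ ‖v‖ ^ 2 := by rw [← sq_abs]; gcongr; exact norm_snd_le v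
  have hR : x.1 ≤ R := hxR
  have hφ : x.2 ≤ |φ₁| * R := hx3.trans (mul_le_mul (le_abs_self _) hR hx1 (abs_nonneg _))
  calc _ ≤ (R ^ 2 + C * (|φ₁| * R) ^ 2) ^ p * R ^ (2 * q) * (‖v‖ ^ 2 + ‖v‖ ^ 2) := by gcongr
    _ = _ := by ring

lemma absolutelyContinuousOnInterval_of_dist_le {f r ρ : ℝ → ℝ} {a b K : ℝ}
    (hr : AbsolutelyContinuousOnInterval r a b) (hρ : AbsolutelyContinuousOnInterval ρ a b)
    (h : ∀ x ∈ Set.uIcc a b, ∀ y ∈ Set.uIcc a b,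
      dist (f x) (f y) ≤ K * (dist (r x) (r y) + dist (ρ x) (ρ y))) :
    AbsolutelyContinuousOnInterval f a b := by
  have key := (Filter.Tendsto.add hr hρ).const_mul K
  simp only [add_zero, mul_zero] at key
  refine squeeze_zero' (Filter.Eventually.of_forall fun E => Finset.sum_nonneg fun i _ => dist_nonneg)
    ?_ key
  refine Filter.eventually_inf_principal.2 (Filter.Eventually.of_forall fun E hE => ?_)
  rw [← Finset.sum_add_distrib, Finset.mul_sum]
  refine Finset.sum_le_sum fun i hi => ?_
  have := hE.1 i hi
  exact h _ this.1 _ this.2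

/-- The increment of the calibration is the integral of its derivative along the curve, which the
gradient bound dominates almost everywhere by the length integrand. -/
lemma IsCalibration.le_canonicalLength {n p q : ℕ} {lam φ₁ : ℝ} {b b' : ℝ → ℝ}
    (h : IsCalibration n p q (lam ^ 2) φ₁ b b') (hn : 0 < n) {P Q : ℝ × ℝ} {r ρ : ℝ → ℝ}
    {s t : ℝ} (hγ : IsCurveIn (sector φ₁) P Q r ρ s t) :
    ENNReal.ofReal (sphereVolume n * (homogeneousExt n b Q - homogeneousExt n b P)) ≤
      canonicalLength n p lam r ρ s t := by
  have hσ : 0 ≤ sphereVolume n := measureReal_nonneg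
  have hst := hγ.le
  set f : ℝ → ℝ := fun x => homogeneousExt n b (r x, ρ x) with hf
  obtain ⟨R, hR⟩ := hγ.ac_fst.exists_bound
  rw [Set.uIcc_of_le hst] at hR
  obtain ⟨K, hK⟩ := h.exists_lipschitz hn (sq_nonneg lam) R
  have hac : AbsolutelyContinuousOnInterval f s t := by
    refine absolutelyContinuousOnInterval_of_dist_le (K := |K|) hγ.ac_fst hγ.ac_snd ?_
    intro x hx y hy
    rw [Set.uIcc_of_le hst] at hx hy
    refine (hK _ (hγ.mem x hx) _ (hγ.mem y hy) ((le_abs_self _).trans (hR x hx))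
      ((le_abs_self _).trans (hR y hy))).trans ?_
    refine mul_le_mul (le_abs_self K) ?_ dist_nonneg (abs_nonneg K)
    exact max_le_add_of_nonneg dist_nonneg dist_nonneg
  have hFTC : f t - f s = ∫ x in s..t, deriv f x := hac.integral_deriv_eq_sub.symm
  have e1 : homogeneousExt n b Q - homogeneousExt n b P = f t - f s := by
    rw [hf, ← hγ.source, ← hγ.target]
  rw [e1, hFTC, ← intervalIntegral.integral_const_mul, intervalIntegral.integral_of_le hst,
    ← integral_Icc_eq_integral_Ioc, canonicalLength]
  have hint : IntegrableOn (fun x => sphereVolume n * deriv f x) (Set.Icc s t) := by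
    rw [integrableOn_Icc_iff_integrableOn_Ioc, ← intervalIntegrable_iff_integrableOn_Ioc_of_le hst]
    exact hac.intervalIntegrable_deriv.const_mul _
  calc ENNReal.ofReal (∫ x in Set.Icc s t, sphereVolume n * deriv f x)
      ≤ ENNReal.ofReal (∫ x in Set.Icc s t, ‖sphereVolume n * deriv f x‖) :=
        ENNReal.ofReal_le_ofReal (integral_mono hint hint.norm fun x => Real.le_norm_self _)
    _ = ∫⁻ x in Set.Icc s t, ‖sphereVolume n * deriv f x‖ₑ :=
        ofReal_integral_norm_eq_lintegral_enorm hint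
    _ ≤ _ := by
      refine lintegral_mono_ae ?_
      refine (ae_restrict_iff' measurableSet_Icc).2 ?_
      -- Away from the endpoints the parameter interval is a neighbourhood, so the derivative within
      -- it is `deriv f`.
      have hs : ∀ᵐ x : ℝ, x ≠ s := by simp [ae_iff, measure_singleton]
      have ht : ∀ᵐ x : ℝ, x ≠ t := by simp [ae_iff, measure_singleton]
      filter_upwards [hγ.ac_fst.ae_differentiableAt, hγ.ac_snd.ae_differentiableAt, hs, ht]
        with x hx1 hx2 hxs hxt hx
      rw [Set.uIcc_of_le hst] at hx1 hx2
      obtain ⟨L, hL, hbd⟩ := h.exists_hasFDerivWithinAt hn (hγ.mem x hx)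
      have hnhds : Set.Icc s t ∈ nhds x :=
        Icc_mem_nhds (lt_of_le_of_ne hx.1 hxs.symm) (lt_of_le_of_ne hx.2 hxt)
      have hd := (hL.comp_hasDerivWithinAt x
        ((hx1 hx).hasDerivAt.prodMk (hx2 hx).hasDerivAt).hasDerivWithinAt
        (fun y hy => hγ.mem y hy)).hasDerivAt hnhds
      have hd' : deriv f x = L (deriv r x, deriv ρ x) := hd.deriv
      rw [← ofReal_norm, norm_mul, Real.norm_of_nonneg hσ, hd']
      refine ENNReal.ofReal_le_ofReal ?_
      refine (mul_le_mul_of_nonneg_left (hbd _) hσ).trans_eq ?_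
      rw [← Real.sqrt_sq hσ, ← Real.sqrt_mul (sq_nonneg _), canonicalFactor,
        ← h.add_eq, Nat.add_sub_cancel_left]
      congr 1
      ring

lemma canonicalLength_ray {n p q : ℕ} (hpq : p + q = n) (lam c : ℝ) {s t : ℝ} (hs : 0 ≤ s)
    (hst : s ≤ t) :
    canonicalLength n p lam (fun r => r) (fun r => c * r) s t =
      ENNReal.ofReal (sphereVolume n * (√((1 + lam ^ 2 * c ^ 2) ^ p * (1 + c ^ 2)) *
        ((t ^ (n + 1) - s ^ (n + 1)) / (n + 1)))) := by
  have hσ : 0 ≤ sphereVolume n := measureReal_nonneg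
  have e : ∀ x ∈ Set.Icc s t, ENNReal.ofReal (√(canonicalFactor n p lam x (c * x) *
      (deriv (fun r : ℝ => r) x ^ 2 + deriv (fun r : ℝ => c * r) x ^ 2))) =
      ENNReal.ofReal (sphereVolume n * √((1 + lam ^ 2 * c ^ 2) ^ p * (1 + c ^ 2)) * x ^ n) := by
    intro x hx
    have hx0 : 0 ≤ x := hs.trans hx.1
    have d1 : deriv (fun r : ℝ => c * r) x = c := by
      simp
    have d2 : deriv (fun r : ℝ => r) x = 1 := (hasDerivAt_id x).deriv
    rw [d1, d2, canonicalFactor, ← hpq, Nat.add_sub_cancel_left]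
    have e1 : sphereVolume (p + q) ^ 2 * ((x ^ 2 + lam ^ 2 * (c * x) ^ 2) ^ p * x ^ (2 * q)) *
        (1 ^ 2 + c ^ 2) =
        (sphereVolume (p + q) * x ^ (p + q)) ^ 2 * ((1 + lam ^ 2 * c ^ 2) ^ p * (1 + c ^ 2)) := by
      have : x ^ 2 + lam ^ 2 * (c * x) ^ 2 = x ^ 2 * (1 + lam ^ 2 * c ^ 2) := by ring
      rw [this, mul_pow]; ring
    rw [e1, Real.sqrt_mul (sq_nonneg _), Real.sqrt_sq (by rw [hpq]; positivity)]
    congr 1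
    ring
  rw [canonicalLength, setLIntegral_congr_fun measurableSet_Icc e]
  rw [← ofReal_integral_eq_lintegral_ofReal, integral_Icc_eq_integral_Ioc,
    ← intervalIntegral.integral_of_le hst, intervalIntegral.integral_const_mul, integral_pow]
  · congr 1
    ring
  · exact (Continuous.integrableOn_Icc (by fun_prop))
  · refine (ae_restrict_iff' measurableSet_Icc).2 (Filter.Eventually.of_forall fun x hx => ?_)
    have hx0 : 0 ≤ x := hs.trans hx.1
    exact mul_nonneg (mul_nonneg hσ (Real.sqrt_nonneg _)) (pow_nonneg hx0 _)

/-- A ray along which a calibration grows at the maximal rate is length-minimizing. -/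
lemma IsCalibration.isMinimizingRayIn {n p q : ℕ} {lam φ₁ c : ℝ} {b b' : ℝ → ℝ}
    (h : IsCalibration n p q (lam ^ 2) φ₁ b b') (hn : 0 < n) (hc : 0 ≤ c) (hc₁ : c ≤ φ₁)
    (hb : (n + 1) * b c = √((1 + lam ^ 2 * c ^ 2) ^ p * (1 + c ^ 2))) :
    IsMinimizingRayIn n p lam (sector φ₁) c := by
  intro s t hs hst
  refine ⟨⟨fun r => r, fun r => c * r, s, t, ⟨hst, ?_, ?_, ?_, rfl, rfl⟩, rfl⟩, ?_⟩
  · exact (contDiff_id (𝕜 := ℝ)).contDiffOn.absolutelyContinuousOnInterval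
  · exact (contDiff_const.mul contDiff_id : ContDiff ℝ 1 fun r : ℝ => c * r).contDiffOn
      |>.absolutelyContinuousOnInterval
  · intro x hx
    have hx0 : 0 ≤ x := hs.trans hx.1
    exact ⟨hx0, mul_nonneg hc hx0, mul_le_mul_of_nonneg_right hc₁ hx0⟩
  · rintro L ⟨r, ρ, a, a', hγ, rfl⟩
    refine le_of_eq_of_le ?_ (h.le_canonicalLength hn hγ)
    rw [canonicalLength_ray h.add_eq lam c hs hst, ← hb]
    -- At `x = 0` the slope is the default `0 / 0 = 0`, but the factor `x ^ (n + 1)` vanishes.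
    have e : ∀ x : ℝ, homogeneousExt n b (x, c * x) = x ^ (n + 1) * b c := by
      intro x
      rw [homogeneousExt]
      rcases eq_or_ne x 0 with h0 | h0
      · subst h0; simp
      · simp only [mul_div_cancel_right₀ c h0]
    rw [e, e]
    congr 2
    field_simp

/-! ### The explicit calibration -/

/-- The restriction of the calibration to `{r = 1}`. -/
def barrier (n p C c τ φ : ℝ) : ℝ :=
  Real.exp (c / 2 * logDensity n p C (φ ^ 2) + (n + 1) / 2 * Real.log (1 + φ ^ 2) -
    (c - 1) / 2 * logDensity n p C τ) / (n + 1)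

lemma hasDerivAt_barrier {n p q a C c τ : ℝ} (hC : 0 ≤ C) (hpq : p + q = n) (ha : a = p * C - n)
    (φ : ℝ) :
    HasDerivAt (barrier n p C c τ) (barrier n p C c τ φ *
      (φ * (c * slopeFactor q a C (φ ^ 2) + (n + 1)) / (1 + φ ^ 2))) φ := by
  have h2 : 0 < 1 + φ ^ 2 := by positivity
  have d0 : HasDerivAt (fun φ : ℝ => φ ^ 2) (2 * φ) φ := by simpa using hasDerivAt_pow 2 φ
  have d1 := (hasDerivAt_logDensity (q := q) hC (sq_nonneg φ) hpq ha).comp_of_eq φ d0 rfl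
  have d2 := (d0.const_add 1).log h2.ne'
  have d3 := ((((d1.const_mul (c / 2)).fun_add (d2.const_mul ((n + 1) / 2))).sub_const
    ((c - 1) / 2 * logDensity n p C τ)).exp).div_const (n + 1)
  refine d3.congr_deriv ?_
  simp only [barrier, Function.comp]
  field_simp

lemma exp_logDensity {n p : ℕ} {C y : ℝ} (hC : 0 ≤ C) (hy : 0 ≤ y) :
    Real.exp (logDensity n p C y + n * Real.log (1 + y)) = (1 + C * y) ^ p := by
  have h1 : 0 < 1 + C * y := by positivity
  rw [logDensity, sub_add_cancel, Real.exp_nat_mul, Real.exp_log h1]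

lemma isCalibration_barrier {n p q : ℕ} {a C c τ φ₁ : ℝ} (hC : 0 < C) (hc : 0 < c)
    (hq : 0 < q) (hpq : p + q = n) (ha : a = p * C - n) (ha0 : 0 ≤ a) (hτ : 0 ≤ τ)
    (hττ : q * C * τ = a) (hτ₁ : τ ≤ φ₁ ^ 2)
    (hcubic : ∀ y, 0 ≤ y → y ≤ φ₁ ^ 2 → 0 ≤ barrierCubic n p q a c (C * y)) :
    IsCalibration n p q C φ₁ (barrier n p C c τ) (fun φ => barrier n p C c τ φ *
      (φ * (c * slopeFactor q a C (φ ^ 2) + (n + 1)) / (1 + φ ^ 2))) := by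
  have hpq' : (p : ℝ) + q = n := by exact_mod_cast hpq
  have hq' : (0 : ℝ) < q := by exact_mod_cast hq
  refine ⟨hpq, hasDerivAt_barrier hC.le hpq' ha, fun φ h0 h1 => ?_⟩
  have hn' : (0 : ℝ) < n := by rw [← hpq']; positivity
  have hle := logRatio_le hn'.le hC hc hq' hpq' ha (by positivity) hτ hττ hτ₁ hcubic
    (sq_nonneg φ) (by gcongr)
  set g := slopeFactor q a C (φ ^ 2) with hg
  set μ := 1 + c ^ 2 / ((n : ℝ) + 1) ^ 2 * (φ ^ 2 * g ^ 2) with hμ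
  have hμ0 : 0 < μ := by positivity
  have h2 : 0 < 1 + φ ^ 2 := by positivity
  have e1 : (((n : ℝ) + 1) * barrier n p C c τ φ - φ * (barrier n p C c τ φ *
      (φ * (c * g + (n + 1)) / (1 + φ ^ 2)))) ^ 2 + (barrier n p C c τ φ *
      (φ * (c * g + (n + 1)) / (1 + φ ^ 2))) ^ 2 =
      ((n + 1) * barrier n p C c τ φ) ^ 2 * (μ / (1 + φ ^ 2)) := by
    rw [hμ]
    field_simp
    ring
  have e2 : ((n + 1) * barrier n p C c τ φ) ^ 2 * (μ / (1 + φ ^ 2)) =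
      Real.exp (logDensity n p C (φ ^ 2) + n * Real.log (1 + φ ^ 2) +
        (logRatio n p q a C c (φ ^ 2) - (c - 1) * logDensity n p C τ)) := by
    rw [barrier, mul_div_cancel₀ _ (by positivity), ← Real.exp_nat_mul,
      show μ / (1 + φ ^ 2) = Real.exp (Real.log μ - Real.log (1 + φ ^ 2)) by
        rw [Real.exp_sub, Real.exp_log hμ0, Real.exp_log h2], ← Real.exp_add, logRatio, ← hg, ← hμ]
    congr 1
    push_cast
    ring
  rw [e1, e2, ← exp_logDensity hC.le (sq_nonneg φ) (n := n)]
  exact Real.exp_le_exp.2 (by linarith)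

/-- At the critical slope the normalization `(c - 1) / 2` brings the exponent `c` of `w` back to
`1`, so the gradient bound is attained on the ray. -/
lemma barrier_eq_sqrt {n p : ℕ} {C c φ : ℝ} (hC : 0 ≤ C) :
    ((n : ℝ) + 1) * barrier n p C c (φ ^ 2) φ = √((1 + C * φ ^ 2) ^ p * (1 + φ ^ 2)) := by
  have h2 : 0 < 1 + φ ^ 2 := by positivity
  rw [← exp_logDensity hC (sq_nonneg φ) (n := n), ← Real.exp_log h2, ← Real.exp_add,
    Real.exp_log h2, ← Real.exp_half, barrier, mul_div_cancel₀ _ (by positivity)]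
  congr 1
  ring

lemma exists_isMinimizingRayIn {n p q k : ℕ} {lam c : ℝ} (hp : 0 < p) (hq : 0 < q)
    (hpq : p + q = n) (hlam : 0 < lam) (hc : 0 < c) (hI : IsTypeI n p k)
    (hk : p * lam ^ 2 = k * (k + n - 1)) (hτ : q * lam ^ 2 * c ^ 2 = p * lam ^ 2 - n) :
    ∃ φ₁, c < φ₁ ∧ IsMinimizingRayIn n p lam (sector φ₁) c := by
  have hq' : (0 : ℝ) < q := by exact_mod_cast hq
  have ha0 : 0 < p * lam ^ 2 - n := by rw [← hτ]; positivity
  obtain ⟨e, he, hcubic⟩ := exists_barrierCubic_nonneg hp hq hpq hI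
    (a := p * lam ^ 2 - n) (by rw [hk]; ring) ha0
  -- `(21 / 20) ^ 2 = 441 / 400` is the margin allowed by `exists_barrierCubic_nonneg`.
  refine ⟨21 / 20 * c, by linarith, ?_⟩
  refine (isCalibration_barrier (a := p * lam ^ 2 - n) (c := e) (τ := c ^ 2) (by positivity)
    (by linarith) hq hpq rfl ha0.le (sq_nonneg c) hτ (by nlinarith [sq_nonneg c])
    fun y hy0 hy1 => hcubic _ (by positivity) ?_).isMinimizingRayIn (by omega) hc.le (by linarith)
    (barrier_eq_sqrt (sq_nonneg lam))
  rw [← hτ]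
  calc lam ^ 2 * y * q ≤ lam ^ 2 * (21 / 20 * c) ^ 2 * q := by gcongr
    _ = _ := by ring

/-! ### Polynomials on Euclidean space -/

lemma eval_smul_of_isHomogeneous {σ : Type*} [Fintype σ] {P : MvPolynomial σ ℝ} {k : ℕ}
    (hP : P.IsHomogeneous k) (c : ℝ) (y : σ → ℝ) :
    MvPolynomial.eval (c • y) P = c ^ k * MvPolynomial.eval y P := by
  rw [MvPolynomial.eval_eq', MvPolynomial.eval_eq', Finset.mul_sum]
  refine Finset.sum_congr rfl fun d hd => ?_
  have h1 : ∑ i, d i = k := by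
    have := hP (MvPolynomial.mem_support_iff.1 hd)
    simpa [Finsupp.weight_apply, Finsupp.sum_fintype] using this
  simp only [Pi.smul_apply, smul_eq_mul, mul_pow, Finset.prod_mul_distrib]
  rw [Finset.prod_pow_eq_pow_sum, h1]
  ring

lemma hasFDerivAt_eval {d : ℕ} (P : MvPolynomial (Fin d) ℝ) (y : Euc d) :
    HasFDerivAt (fun z : Euc d => MvPolynomial.eval z P)
      (∑ i, MvPolynomial.eval y (MvPolynomial.pderiv i P) • EuclideanSpace.proj (𝕜 := ℝ) i) y := by
  induction P using MvPolynomial.induction_on with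
  | C a => simpa using hasFDerivAt_const a y
  | add P Q hP hQ =>
    simp only [map_add]
    refine (hP.add hQ).congr_fderiv ?_
    simp [add_smul, Finset.sum_add_distrib]
  | mul_X P j hP =>
    simp only [map_mul, MvPolynomial.eval_X]
    refine (hP.mul (EuclideanSpace.proj (𝕜 := ℝ) j : Euc d →L[ℝ] ℝ).hasFDerivAt).congr_fderiv ?_
    ext v
    simp [MvPolynomial.pderiv_X, Pi.single_apply, Finset.mul_sum, add_mul,
      Finset.sum_add_distrib]
    simp [apply_ite (MvPolynomial.eval y.ofLp), ite_mul, mul_assoc]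

lemma contDiff_eval {d : ℕ} (P : MvPolynomial (Fin d) ℝ) {r : WithTop ℕ∞} :
    ContDiff ℝ r (fun z : Euc d => MvPolynomial.eval z P) := by
  induction P using MvPolynomial.induction_on with
  | C a => simpa using contDiff_const
  | add P Q hP hQ => simpa using hP.add hQ
  | mul_X P j hP =>
    simpa using hP.mul (EuclideanSpace.proj (𝕜 := ℝ) j : Euc d →L[ℝ] ℝ).contDiff

lemma pderiv_two {σ : Type*} (i : σ) : MvPolynomial.pderiv i (2 : MvPolynomial σ ℝ) = 0 := by
  simpa using (MvPolynomial.pderiv i : Derivation ℝ (MvPolynomial σ ℝ) _).map_natCast 2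

/-- The formal Laplacian of `(∑ X_i²)^k`. -/
lemma sum_pderiv_pderiv_pow {d : ℕ} (k : ℕ) (y : Fin d → ℝ) (hy : ∑ i, y i ^ 2 = 1) :
    ∑ i, MvPolynomial.eval y (MvPolynomial.pderiv i (MvPolynomial.pderiv i
      ((∑ j, MvPolynomial.X j ^ 2 : MvPolynomial (Fin d) ℝ) ^ k))) =
      4 * k * (k - 1) + 2 * k * d := by
  set S : MvPolynomial (Fin d) ℝ := ∑ j, MvPolynomial.X j ^ 2 with hS
  have hS1 : MvPolynomial.eval y S = 1 := by simp [hS, hy]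
  have hd : ∀ i, MvPolynomial.pderiv i S = 2 * MvPolynomial.X i := by
    intro i
    simp [hS, MvPolynomial.pderiv_X, Pi.single_apply]
  have h2 : ∀ i, MvPolynomial.eval y (MvPolynomial.pderiv i (MvPolynomial.pderiv i (S ^ k))) =
      4 * k * (k - 1) * y i ^ 2 + 2 * k := by
    intro i
    rw [MvPolynomial.pderiv_pow, hd, Derivation.leibniz, Derivation.leibniz]
    rcases k with _ | k
    · simp
    · simp [hd, hS1, pderiv_two]
      ring
  simp only [h2, Finset.sum_add_distrib, ← Finset.mul_sum, hy]
  simp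
  ring

/-- If harmonic homogeneous polynomials of degree `k` satisfy `∑ P_j² = 1` on the unit sphere, then
the Dirichlet energy density of the map with these components is constant there. -/
lemma sum_eval_pderiv_sq {d l k : ℕ} {P : Fin l → MvPolynomial (Fin d) ℝ}
    (hhom : ∀ j, (P j).IsHomogeneous k)
    (hharm : ∀ j, ∑ i, MvPolynomial.pderiv i (MvPolynomial.pderiv i (P j)) = 0)
    (hone : ∀ y : Fin d → ℝ, ∑ i, y i ^ 2 = 1 → ∑ j, MvPolynomial.eval y (P j) ^ 2 = 1)
    {y : Fin d → ℝ} (hy : ∑ i, y i ^ 2 = 1) :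
    ∑ j, ∑ i, MvPolynomial.eval y (MvPolynomial.pderiv i (P j)) ^ 2 =
      2 * k * (k - 1) + k * d := by
  -- By homogeneity `∑ P_j²` is `|z| ^ (2 k)`. The extra factor `|z| ^ 2` spares the origin, where
  -- rescaling to the sphere is impossible; it is cancelled afterwards. The Laplacian of both sides
  -- then gives the energy density.
  have hid : (∑ j, P j ^ 2) * (∑ i, MvPolynomial.X i ^ 2) =
      (∑ i, MvPolynomial.X i ^ 2 : MvPolynomial (Fin d) ℝ) ^ k * (∑ i, MvPolynomial.X i ^ 2) := by
    refine MvPolynomial.funext fun z => ?_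
    simp only [map_mul, map_pow, map_sum, MvPolynomial.eval_X]
    rcases eq_or_ne (∑ i, z i ^ 2) 0 with h0 | h0
    · rw [h0, mul_zero, mul_zero]
    · have hpos : 0 < ∑ i, z i ^ 2 := (Finset.sum_nonneg fun i _ => sq_nonneg _).lt_of_ne' h0
      congr 1
      set t := √(∑ i, z i ^ 2) with ht
      have ht0 : 0 < t := Real.sqrt_pos.2 hpos
      have ht2 : t ^ 2 = ∑ i, z i ^ 2 := Real.sq_sqrt hpos.le
      have hz : z = t • (t⁻¹ • z) := by rw [smul_smul, mul_inv_cancel₀ ht0.ne', one_smul]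
      have hw : ∑ i, (t⁻¹ • z) i ^ 2 = 1 := by
        simp only [Pi.smul_apply, smul_eq_mul, mul_pow, ← Finset.mul_sum]
        rw [← ht2]
        field_simp
      have hP : ∀ j, MvPolynomial.eval z (P j) ^ 2 =
          t ^ (2 * k) * MvPolynomial.eval (t⁻¹ • z) (P j) ^ 2 := by
        intro j
        conv_lhs => rw [hz, eval_smul_of_isHomogeneous (hhom j)]
        ring
      simp only [hP, ← Finset.mul_sum]
      rw [hone _ hw, mul_one, pow_mul, ht2]
  have hid' : ∑ j, P j ^ 2 = (∑ i, MvPolynomial.X i ^ 2 : MvPolynomial (Fin d) ℝ) ^ k := by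
    refine mul_right_cancel₀ (fun h0 => ?_) hid
    have := congrArg (MvPolynomial.eval y) h0
    simp [hy] at this
  have h1 : ∑ i, MvPolynomial.eval y (MvPolynomial.pderiv i (MvPolynomial.pderiv i
      (∑ j, P j ^ 2))) =
      2 * ∑ j, ∑ i, MvPolynomial.eval y (MvPolynomial.pderiv i (P j)) ^ 2 := by
    have h2 : ∀ i j, MvPolynomial.eval y (MvPolynomial.pderiv i (MvPolynomial.pderiv i (P j ^ 2))) =
        2 * MvPolynomial.eval y (MvPolynomial.pderiv i (P j)) ^ 2 + 2 * MvPolynomial.eval y (P j) *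
          MvPolynomial.eval y (MvPolynomial.pderiv i (MvPolynomial.pderiv i (P j))) := by
      intro i j
      simp [Derivation.leibniz, pderiv_two]
      ring
    have h3 : ∀ j, ∑ i, MvPolynomial.eval y (MvPolynomial.pderiv i (MvPolynomial.pderiv i (P j))) =
        0 := by
      intro j
      rw [← map_sum, hharm, map_zero]
    simp only [map_sum, h2]
    rw [Finset.sum_comm, Finset.mul_sum]
    refine Finset.sum_congr rfl fun j _ => ?_
    rw [Finset.sum_add_distrib, ← Finset.mul_sum, ← Finset.mul_sum, h3, mul_zero, add_zero]
  rw [hid', sum_pderiv_pderiv_pow k y hy] at h1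
  linarith

/-! ### Calculus of radial extensions -/

lemma mem_tangent_iff {n : ℕ} {x : Sph n} {v : Euc (n + 1)} :
    v ∈ tangent x ↔ ⟪(x : Euc (n + 1)), v⟫_ℝ = 0 :=
  Submodule.mem_orthogonal_singleton_iff_inner_right

lemma norm_coe_sph {n : ℕ} (x : Sph n) : ‖(x : Euc (n + 1))‖ = 1 := mem_sphere_zero_iff_norm.1 x.2

lemma coe_sph_ne_zero {n : ℕ} (x : Sph n) : (x : Euc (n + 1)) ≠ 0 := by
  intro h
  have := norm_coe_sph x
  simp [h] at this

section

variable {n : ℕ} {V : Type*} [NormedAddCommGroup V]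

lemma exists_radialExt_eq (h : Sph n → V) {y : Euc (n + 1)} (hy : y ≠ 0) :
    ∃ x : Sph n, (x : Euc (n + 1)) = ‖y‖⁻¹ • y ∧ radialExt h y = h x := by
  rw [radialExt, dif_neg hy]
  exact ⟨_, rfl, rfl⟩

lemma radialExt_coe (h : Sph n → V) (x : Sph n) : radialExt h (x : Euc (n + 1)) = h x := by
  obtain ⟨x', hx', e⟩ := exists_radialExt_eq h (coe_sph_ne_zero x)
  rw [e]
  congr 1
  ext1
  rw [hx', norm_coe_sph, inv_one, one_smul]

lemma eventually_ne_zero (x : Sph n) : ∀ᶠ y : Euc (n + 1) in nhds (x : Euc (n + 1)), y ≠ 0 :=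
  isOpen_ne.mem_nhds (coe_sph_ne_zero x)

end

/-- The norm has vanishing derivative in tangential directions. -/
lemma hasFDerivAt_norm_sph {n : ℕ} (x : Sph n) :
    HasFDerivAt (fun y : Euc (n + 1) => ‖y‖) (innerSL ℝ (x : Euc (n + 1))) (x : Euc (n + 1)) := by
  have h1 : HasFDerivAt (fun y : Euc (n + 1) => ‖y‖ ^ 2) (2 • innerSL ℝ (x : Euc (n + 1)))
      (x : Euc (n + 1)) := (hasStrictFDerivAt_norm_sq _).hasFDerivAt
  have h2 := h1.sqrt (by simp [norm_coe_sph x])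
  simp only [Real.sqrt_sq (norm_nonneg _), norm_coe_sph] at h2
  refine h2.congr_fderiv ?_
  ext v
  simp

/-! ### Derivatives of maps into a unit sphere -/

section Unit

variable {E W : Type*} [NormedAddCommGroup E] [NormedSpace ℝ E] [NormedAddCommGroup W]
  [InnerProductSpace ℝ W]

lemma inner_fderiv_of_norm_eq_one {G : E → W} {x : E} (hG : DifferentiableAt ℝ G x)
    (h1 : ∀ᶠ y in nhds x, ‖G y‖ = 1) (v : E) : ⟪G x, fderiv ℝ G x v⟫_ℝ = 0 := by
  have h2 : HasFDerivAt (fun y => ⟪G y, G y⟫_ℝ) (0 : E →L[ℝ] ℝ) x := by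
    refine (hasFDerivAt_const (1 : ℝ) x).congr_of_eventuallyEq ?_
    filter_upwards [h1] with y hy
    rw [real_inner_self_eq_norm_sq, hy, one_pow]
  have h3 := hG.hasFDerivAt.inner ℝ hG.hasFDerivAt
  have h4 := congrArg (fun L : E →L[ℝ] ℝ => L v) (h3.unique h2)
  simp [real_inner_comm] at h4
  exact h4

/-- Differentiate `⟪G, dG v⟫ = 0` once more in the direction `v`. -/
lemma inner_iteratedFDeriv_two_of_norm_eq_one {G : E → W} {x : E} (hG : ContDiffAt ℝ 2 G x)
    (h1 : ∀ᶠ y in nhds x, ‖G y‖ = 1) (v : E) :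
    ⟪G x, iteratedFDeriv ℝ 2 G x (fun _ => v)⟫_ℝ = -‖fderiv ℝ G x v‖ ^ 2 := by
  rw [iteratedFDeriv_two_apply]
  have hd : DifferentiableAt ℝ (fderiv ℝ G) x :=
    (hG.fderiv_right (m := 1) (by norm_num)).differentiableAt (by norm_num)
  have h2 : HasFDerivAt (fun y => ⟪G y, fderiv ℝ G y v⟫_ℝ) (0 : E →L[ℝ] ℝ) x := by
    refine (hasFDerivAt_const (0 : ℝ) x).congr_of_eventuallyEq ?_
    filter_upwards [h1.eventually_nhds, hG.eventually (by simp)] with y hy hy'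
    exact inner_fderiv_of_norm_eq_one (hy'.differentiableAt (by norm_num)) hy v
  have h3 := (hG.differentiableAt (by norm_num)).hasFDerivAt.inner ℝ
    (hd.hasFDerivAt.clm_apply (hasFDerivAt_const v x))
  have h4 := congrArg (fun L : E →L[ℝ] ℝ => L v) (h3.unique h2)
  simp at h4
  linarith

end Unit

lemma radialExt_coe_eq {n : ℕ} {y : Euc (n + 1)} (hy : y ≠ 0) :
    radialExt (fun x : Sph n => (x : Euc (n + 1))) y = ‖y‖⁻¹ • y := by
  obtain ⟨x, hx, e⟩ := exists_radialExt_eq (fun x : Sph n => (x : Euc (n + 1))) hy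
  rw [e, hx]

lemma contDiffAt_radialExt_coe {n : ℕ} (x : Sph n) {r : WithTop ℕ∞} :
    ContDiffAt ℝ r (radialExt fun x : Sph n => (x : Euc (n + 1))) (x : Euc (n + 1)) := by
  refine ContDiffAt.congr_of_eventuallyEq (f := fun y => ‖y‖⁻¹ • y) ?_
    ((eventually_ne_zero x).mono fun y hy => radialExt_coe_eq hy)
  exact ((contDiffAt_norm ℝ (coe_sph_ne_zero x)).inv
    (norm_ne_zero_iff.2 (coe_sph_ne_zero x))).smul contDiffAt_id

lemma sphereDeriv_coe {n : ℕ} (x : Sph n) {v : Euc (n + 1)} (hv : v ∈ tangent x) :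
    sphereDeriv (fun x : Sph n => (x : Euc (n + 1))) x v = v := by
  have h1 : HasFDerivAt (fun y : Euc (n + 1) => ‖y‖⁻¹ • y) _ (x : Euc (n + 1)) :=
    ((hasDerivAt_inv (norm_ne_zero_iff.2 (coe_sph_ne_zero x))).comp_hasFDerivAt _
      (hasFDerivAt_norm_sph x)).smul (hasFDerivAt_id _)
  have h2 := h1.congr_of_eventuallyEq
    ((eventually_ne_zero x).mono fun y hy => radialExt_coe_eq hy)
  rw [sphereDeriv, h2.fderiv]
  simp [mem_tangent_iff.1 hv]

/-! ### Spherical harmonics -/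

section Harmonic

variable {n m k : ℕ} {f : Sph n → Sph m} {P : Fin (m + 1) → MvPolynomial (Fin (n + 1)) ℝ}

/-- The map between Euclidean spaces with components `P j`. -/
def polyMap (P : Fin (m + 1) → MvPolynomial (Fin (n + 1)) ℝ) (y : Euc (n + 1)) : Euc (m + 1) :=
  WithLp.toLp 2 fun j => MvPolynomial.eval y (P j)

lemma contDiff_polyMap {r : WithTop ℕ∞} : ContDiff ℝ r (polyMap P) :=
  (contDiff_piLp 2).2 fun j => contDiff_eval (P j)

lemma radialExt_eq_polyMap (hhom : ∀ j, (P j).IsHomogeneous k)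
    (hP : ∀ j, ∀ x : Sph n, (f x : Euc (m + 1)) j =
      MvPolynomial.eval (fun i => (x : Euc (n + 1)) i) (P j))
    {y : Euc (n + 1)} (hy : y ≠ 0) :
    radialExt (fun x => (f x : Euc (m + 1))) y = (‖y‖⁻¹ ^ k) • polyMap P y := by
  obtain ⟨x, hx, e⟩ := exists_radialExt_eq (fun x => (f x : Euc (m + 1))) hy
  rw [e]
  ext j
  rw [hP, hx]
  exact eval_smul_of_isHomogeneous (hhom j) _ _

lemma contDiffAt_radialExt (hhom : ∀ j, (P j).IsHomogeneous k)
    (hP : ∀ j, ∀ x : Sph n, (f x : Euc (m + 1)) j =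
      MvPolynomial.eval (fun i => (x : Euc (n + 1)) i) (P j))
    (x : Sph n) {r : WithTop ℕ∞} :
    ContDiffAt ℝ r (radialExt fun x => (f x : Euc (m + 1))) (x : Euc (n + 1)) := by
  refine ContDiffAt.congr_of_eventuallyEq (f := fun y => (‖y‖⁻¹ ^ k) • polyMap P y) ?_
    ((eventually_ne_zero x).mono fun y hy => radialExt_eq_polyMap hhom hP hy)
  exact (((contDiffAt_norm ℝ (coe_sph_ne_zero x)).inv
    (norm_ne_zero_iff.2 (coe_sph_ne_zero x))).pow k).smul contDiff_polyMap.contDiffAt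

/-- The two extensions differ by a power of the norm, which equals `1` at `x` and is stationary in
tangential directions. -/
lemma sphereDeriv_eq_fderiv_polyMap (hhom : ∀ j, (P j).IsHomogeneous k)
    (hP : ∀ j, ∀ x : Sph n, (f x : Euc (m + 1)) j =
      MvPolynomial.eval (fun i => (x : Euc (n + 1)) i) (P j))
    (x : Sph n) {v : Euc (n + 1)} (hv : v ∈ tangent x) :
    sphereDeriv (fun x => (f x : Euc (m + 1))) x v = fderiv ℝ (polyMap P) (x : Euc (n + 1)) v := by
  have h1 : HasFDerivAt (fun y : Euc (n + 1) => (‖y‖⁻¹ ^ k) • polyMap P y) _ (x : Euc (n + 1)) :=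
    ((hasDerivAt_pow k _).comp_hasFDerivAt _
      ((hasDerivAt_inv (norm_ne_zero_iff.2 (coe_sph_ne_zero x))).comp_hasFDerivAt _
      (hasFDerivAt_norm_sph x))).smul
        ((contDiff_polyMap (r := 1)).differentiable (by norm_num) _).hasFDerivAt
  have h2 := h1.congr_of_eventuallyEq
    ((eventually_ne_zero x).mono fun y hy => radialExt_eq_polyMap hhom hP hy)
  rw [sphereDeriv, h2.fderiv]
  simp [mem_tangent_iff.1 hv]

lemma fderiv_polyMap_apply (y v : Euc (n + 1)) (j : Fin (m + 1)) :
    fderiv ℝ (polyMap P) y v j = ∑ i, MvPolynomial.eval y (MvPolynomial.pderiv i (P j)) * v i := by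
  have h : HasFDerivAt (fun z => polyMap P z j) _ y :=
    ((EuclideanSpace.proj (𝕜 := ℝ) j : Euc (m + 1) →L[ℝ] ℝ).hasFDerivAt).comp y
      ((contDiff_polyMap (P := P) (r := 1)).differentiable (by norm_num) y).hasFDerivAt
  have := congrArg (fun L : Euc (n + 1) →L[ℝ] ℝ => L v) (h.unique (hasFDerivAt_eval (P j) y))
  simpa using this

lemma fderiv_polyMap_self (hhom : ∀ j, (P j).IsHomogeneous k) (y : Euc (n + 1)) :
    fderiv ℝ (polyMap P) y y = (k : ℝ) • polyMap P y := by
  ext j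
  rw [fderiv_polyMap_apply]
  have := congrArg (MvPolynomial.eval y) (hhom j).sum_X_mul_pderiv
  simp only [map_sum, map_mul, MvPolynomial.eval_X, nsmul_eq_mul, map_natCast] at this
  simpa [polyMap, mul_comm] using this

end Harmonic

/-! ### Adapted frames -/

lemma finrank_tangent {n : ℕ} (x : Sph n) : Module.finrank ℝ (tangent x) = n := by
  have : Fact (Module.finrank ℝ (Euc (n + 1)) = n + 1) := ⟨by simp⟩
  exact Submodule.finrank_orthogonal_span_singleton (coe_sph_ne_zero x)

lemma exists_frame {n p q : ℕ} (hpq : p + q = n) {x : Sph n} {H : Submodule ℝ (Euc (n + 1))}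
    (hH : H ≤ tangent x) (hp : Module.finrank ℝ H = p) :
    ∃ u : Fin p ⊕ Fin q → Euc (n + 1), Orthonormal ℝ u ∧ (∀ i, u (Sum.inl i) ∈ H) ∧
      ∀ i, u (Sum.inr i) ∈ tangent x ⊓ Hᗮ := by
  have hq : Module.finrank ℝ (tangent x ⊓ Hᗮ : Submodule ℝ (Euc (n + 1))) = q := by
    have := Submodule.finrank_add_inf_finrank_orthogonal hH
    rw [finrank_tangent, hp, inf_comm] at this
    omega
  let b₁ := (stdOrthonormalBasis ℝ H).reindex (finCongr hp)
  let b₂ := (stdOrthonormalBasis ℝ (tangent x ⊓ Hᗮ : Submodule ℝ (Euc (n + 1)))).reindex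
    (finCongr hq)
  have h₁ : ∀ i j, ⟪(b₁ i : Euc (n + 1)), b₁ j⟫_ℝ = if i = j then 1 else 0 :=
    fun i j => orthonormal_iff_ite.1 b₁.orthonormal i j
  have h₂ : ∀ i j, ⟪(b₂ i : Euc (n + 1)), b₂ j⟫_ℝ = if i = j then 1 else 0 :=
    fun i j => orthonormal_iff_ite.1 b₂.orthonormal i j
  have h₁₂ : ∀ i j, ⟪(b₁ i : Euc (n + 1)), b₂ j⟫_ℝ = 0 :=
    fun i j => (b₂ j).2.2 _ (b₁ i).2
  refine ⟨Sum.elim (fun i => b₁ i) (fun i => b₂ i), orthonormal_iff_ite.2 ?_,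
    fun i => (b₁ i).2, fun i => (b₂ i).2⟩
  rintro (i | i) (j | j)
  · simp [h₁]
  · simp [h₁₂]
  · simp [real_inner_comm, h₁₂]
  · simp [h₂]

lemma frame_mem_tangent {n p q : ℕ} {x : Sph n} {H : Submodule ℝ (Euc (n + 1))}
    (hH : H ≤ tangent x) {u : Fin p ⊕ Fin q → Euc (n + 1)} (hu₁ : ∀ i, u (Sum.inl i) ∈ H)
    (hu₂ : ∀ i, u (Sum.inr i) ∈ tangent x ⊓ Hᗮ) (i : Fin p ⊕ Fin q) : u i ∈ tangent x := by
  rcases i with i | i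
  · exact hH (hu₁ i)
  · exact (hu₂ i).1

lemma inner_map_map_of_norm_map {E F : Type*} [NormedAddCommGroup E] [InnerProductSpace ℝ E]
    [NormedAddCommGroup F] [InnerProductSpace ℝ F] {A : E →L[ℝ] F} {H : Submodule ℝ E} {lam : ℝ}
    (hA : ∀ v ∈ H, ‖A v‖ = lam * ‖v‖) {v w : E} (hv : v ∈ H) (hw : w ∈ H) :
    ⟪A v, A w⟫_ℝ = lam ^ 2 * ⟪v, w⟫_ℝ := by
  rw [real_inner_eq_norm_mul_self_add_norm_mul_self_sub_norm_sub_mul_self_div_two,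
    real_inner_eq_norm_mul_self_add_norm_mul_self_sub_norm_sub_mul_self_div_two, ← map_sub,
    hA _ hv, hA _ hw, hA _ (H.sub_mem hv hw)]
  ring

lemma nonempty_sph (n : ℕ) : Nonempty (Sph n) :=
  ⟨⟨EuclideanSpace.single 0 1, by simp⟩⟩

/-! ### Relations between the invariants -/

/-- The energy density of a map all of whose components are spherical harmonics of degree `k` is
the corresponding eigenvalue of the Laplacian. -/
lemma singularValue_relation {n m p q k : ℕ} {f : Sph n → Sph m} {lam : ℝ} (hpq : p + q = n)
    (hs : HasSingularValues f p lam) (hd : HasHarmonicDegree f k) :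
    (p : ℝ) * lam ^ 2 = k * (k + n - 1) := by
  choose P hhom hharm hP using hd
  obtain ⟨x⟩ := nonempty_sph n
  obtain ⟨H, hH, hp, hlam, hzero⟩ := hs.exists_horizontal x
  obtain ⟨u, hu, hu₁, hu₂⟩ := exists_frame hpq hH hp
  have hut := frame_mem_tangent hH hu₁ hu₂
  -- Adding the radial direction gives an orthonormal basis of the ambient space, in which the full
  -- squared gradient can be computed.
  let v : Option (Fin p ⊕ Fin q) → Euc (n + 1) := fun i => i.elim (x : Euc (n + 1)) u
  have hv : Orthonormal ℝ v := by
    rw [orthonormal_iff_ite]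
    rintro (_ | i) (_ | j)
    · simp [v]
    · simpa [v] using mem_tangent_iff.1 (hut j)
    · simpa [v, real_inner_comm] using mem_tangent_iff.1 (hut i)
    · simpa [v] using orthonormal_iff_ite.1 hu i j
  obtain ⟨b, hb⟩ := Orthonormal.exists_orthonormalBasis_extension_of_card_eq (v := v)
    (s := Set.univ) (by simp [← hpq]) (hv.comp _ Subtype.val_injective)
  have hone : ∀ y : Fin (n + 1) → ℝ, ∑ i, y i ^ 2 = 1 →
      ∑ j, MvPolynomial.eval y (P j) ^ 2 = 1 := by
    intro y hy
    let y' : Sph n := ⟨WithLp.toLp 2 y, by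
      rw [mem_sphere_zero_iff_norm, EuclideanSpace.norm_eq]; simp [hy]⟩
    have h1 := norm_coe_sph (f y')
    rw [EuclideanSpace.norm_eq, Real.sqrt_eq_one] at h1
    rw [← h1]
    refine Finset.sum_congr rfl fun j _ => ?_
    rw [hP j y', Real.norm_eq_abs, sq_abs]
  have hx : ∑ i, (x : Euc (n + 1)) i ^ 2 = 1 := by
    have := norm_coe_sph x
    rw [EuclideanSpace.norm_eq, Real.sqrt_eq_one] at this
    simpa using this
  have hsum := sum_eval_pderiv_sq hhom hharm hone hx
  set A := fderiv ℝ (polyMap P) (x : Euc (n + 1)) with hA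
  have hF : ∑ i, ‖A (v i)‖ ^ 2 =
      ∑ j, ∑ i, MvPolynomial.eval (x : Euc (n + 1)) (MvPolynomial.pderiv i (P j)) ^ 2 := by
    simp only [EuclideanSpace.norm_sq_eq]
    rw [Finset.sum_comm]
    refine Finset.sum_congr rfl fun j _ => ?_
    have h1 := b.sum_sq_norm_inner_right (WithLp.toLp 2 fun i =>
      MvPolynomial.eval (x : Euc (n + 1)) (MvPolynomial.pderiv i (P j)))
    rw [EuclideanSpace.norm_sq_eq] at h1
    simp only [Real.norm_eq_abs, sq_abs] at h1 ⊢
    rw [← h1]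
    refine Finset.sum_congr rfl fun i _ => ?_
    rw [hb i (Set.mem_univ i), hA, fderiv_polyMap_apply, PiLp.inner_apply]
    simp
  -- Euler's identity: the radial derivative has length `k`. Subtracting its square from the full
  -- energy leaves `p * lam ^ 2`.
  have hAx : ‖A (v none)‖ ^ 2 = k ^ 2 := by
    have h1 : polyMap P (x : Euc (n + 1)) = f x := by
      ext j; rw [hP j x]; rfl
    change ‖A (x : Euc (n + 1))‖ ^ 2 = _
    rw [hA, fderiv_polyMap_self hhom, norm_smul, h1, norm_coe_sph]
    simp
  have hAu : ∀ i, A (v (some i)) = sphereDeriv (fun y => (f y : Euc (m + 1))) x (u i) :=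
    fun i => (sphereDeriv_eq_fderiv_polyMap hhom hP x (hut i)).symm
  have hAl : ∀ i : Fin p, ‖A (v (some (Sum.inl i)))‖ ^ 2 = lam ^ 2 := by
    intro i
    rw [hAu, hlam _ (hu₁ i), hu.1, mul_one]
  have hAr : ∀ i : Fin q, ‖A (v (some (Sum.inr i)))‖ ^ 2 = 0 := by
    intro i
    rw [hAu, hzero _ (hu₂ i)]
    simp
  rw [Fintype.sum_option, Fintype.sum_sum_type, hAx, hsum] at hF
  simp only [hAl, hAr, Finset.sum_const, Finset.card_univ, Fintype.card_fin, nsmul_eq_mul] at hF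
  push_cast at hF
  linarith

/-! ### Minimality of the Lawson-Osserman sphere -/

section LosMap

variable {n m : ℕ} {f : Sph n → Sph m} {θ : ℝ}

lemma radialExt_losMap (y : Euc (n + 1)) :
    radialExt (losMap f θ) y = WithLp.toLp 2
      (Real.cos θ • radialExt (fun x : Sph n => (x : Euc (n + 1))) y,
        Real.sin θ • radialExt (fun x => (f x : Euc (m + 1))) y) := by
  by_cases hy : y = 0
  · simp [radialExt, hy]
    rfl
  · simp [radialExt, hy, losMap]

lemma contDiffAt_radialExt_losMap {x : Sph n} {r : WithTop ℕ∞}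
    (hf : ContDiffAt ℝ r (radialExt fun x => (f x : Euc (m + 1))) (x : Euc (n + 1))) :
    ContDiffAt ℝ r (radialExt (losMap f θ)) (x : Euc (n + 1)) := by
  rw [funext radialExt_losMap]
  exact (WithLp.prodContinuousLinearEquiv 2 ℝ (Euc (n + 1)) (Euc (m + 1))).symm.contDiff.contDiffAt.comp
    _ (((contDiffAt_radialExt_coe x).const_smul _).prodMk (hf.const_smul _))

lemma sphereDeriv_losMap {x : Sph n}
    (hf : ContDiffAt ℝ 1 (radialExt fun x => (f x : Euc (m + 1))) (x : Euc (n + 1)))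
    {v : Euc (n + 1)} (hv : v ∈ tangent x) :
    sphereDeriv (losMap f θ) x v = WithLp.toLp 2 (Real.cos θ • v,
      Real.sin θ • sphereDeriv (fun x => (f x : Euc (m + 1))) x v) := by
  have hX := ((contDiffAt_radialExt_losMap (θ := θ) hf).differentiableAt one_ne_zero).hasFDerivAt
  have h1 := ((WithLp.fstL 2 ℝ (Euc (n + 1)) (Euc (m + 1))).hasFDerivAt.comp _ hX).unique
    ((((contDiffAt_radialExt_coe x).differentiableAt one_ne_zero).hasFDerivAt.const_smul
      (Real.cos θ)).congr_of_eventuallyEq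
        (Filter.Eventually.of_forall fun y => by simp [radialExt_losMap]))
  have h2 := ((WithLp.sndL 2 ℝ (Euc (n + 1)) (Euc (m + 1))).hasFDerivAt.comp _ hX).unique
    (((hf.differentiableAt one_ne_zero).hasFDerivAt.const_smul
      (Real.sin θ)).congr_of_eventuallyEq
        (Filter.Eventually.of_forall fun y => by simp [radialExt_losMap]))
  have h3 := sphereDeriv_coe x hv
  rw [sphereDeriv] at h3
  refine WithLp.ofLp_injective 2 (Prod.ext ?_ ?_)
  · refine (congrArg (fun L => L v) h1).trans ?_
    simp [h3]
  · exact congrArg (fun L => L v) h2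

lemma fst_sphereSecondDeriv_losMap {x : Sph n}
    (hf : ContDiffAt ℝ 2 (radialExt fun x => (f x : Euc (m + 1))) (x : Euc (n + 1)))
    (v : Euc (n + 1)) :
    (sphereSecondDeriv (losMap f θ) x v).fst =
      Real.cos θ • sphereSecondDeriv (fun x : Sph n => (x : Euc (n + 1))) x v := by
  have h1 := (WithLp.fstL 2 ℝ (Euc (n + 1)) (Euc (m + 1))).iteratedFDeriv_comp_left
    (contDiffAt_radialExt_losMap (θ := θ) hf) (i := 2) le_rfl
  have h2 : (WithLp.fstL 2 ℝ (Euc (n + 1)) (Euc (m + 1))) ∘ radialExt (losMap f θ) =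
      Real.cos θ • radialExt (fun x : Sph n => (x : Euc (n + 1))) := by
    funext y
    simp [radialExt_losMap]
  rw [h2, iteratedFDeriv_const_smul_apply (contDiffAt_radialExt_coe x)] at h1
  have h3 := congrArg (fun L => L fun _ => v) h1
  exact h3.symm

lemma inner_sphereSecondDeriv_coe (x : Sph n) {v : Euc (n + 1)} (hv : v ∈ tangent x) :
    ⟪(x : Euc (n + 1)), sphereSecondDeriv (fun x : Sph n => (x : Euc (n + 1))) x v⟫_ℝ =
      -‖v‖ ^ 2 := by
  have h1 := inner_iteratedFDeriv_two_of_norm_eq_one (contDiffAt_radialExt_coe x)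
    ((eventually_ne_zero x).mono fun y hy => by
      obtain ⟨x', -, e⟩ := exists_radialExt_eq (fun x : Sph n => (x : Euc (n + 1))) hy
      rw [e, norm_coe_sph]) v
  rw [radialExt_coe] at h1
  have h2 := sphereDeriv_coe x hv
  rw [sphereDeriv] at h2
  rwa [h2] at h1

end LosMap

/-- The trace of the round metric with respect to the induced metric on a minimal
Lawson-Osserman sphere is the dimension. -/
lemma sum_norm_sq_eq_of_isMinimalInSphere {n m : ℕ} {f : Sph n → Sph m} {θ : ℝ}
    (hmin : IsMinimalInSphere (losMap f θ)) (hθ : Real.cos θ ≠ 0) {x : Sph n}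
    (hf : ContDiffAt ℝ 2 (radialExt fun x => (f x : Euc (m + 1))) (x : Euc (n + 1)))
    {e : Fin n → Euc (n + 1)} (het : ∀ i, e i ∈ tangent x)
    (he : ∀ i j, ⟪sphereDeriv (losMap f θ) x (e i), sphereDeriv (losMap f θ) x (e j)⟫_ℝ =
      if i = j then 1 else 0) :
    ∑ i, ‖e i‖ ^ 2 = n := by
  have hX := contDiffAt_radialExt_losMap (θ := θ) hf
  have hnorm : ∀ᶠ y in nhds (x : Euc (n + 1)), ‖radialExt (losMap f θ) y‖ = 1 :=
    (eventually_ne_zero x).mono fun y hy => by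
      obtain ⟨x', -, e⟩ := exists_radialExt_eq (losMap f θ) hy
      rw [e, hmin.norm_eq_one]
  obtain ⟨y, hy, z, hz, hyz⟩ := Submodule.mem_sup.1 (hmin.mean_curvature_eq_zero x e het he)
  obtain ⟨a, rfl⟩ := Submodule.mem_span_singleton.1 hy
  obtain ⟨w, hw, rfl⟩ := Submodule.mem_map.1 hz
  have h1 : ∑ i, ⟪losMap f θ x, sphereSecondDeriv (losMap f θ) x (e i)⟫_ℝ = -n := by
    have : ∀ i, ⟪losMap f θ x, sphereSecondDeriv (losMap f θ) x (e i)⟫_ℝ = -1 := by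
      intro i
      have h := inner_iteratedFDeriv_two_of_norm_eq_one hX hnorm (e i)
      have h' := he i i
      rw [real_inner_self_eq_norm_sq, if_pos rfl, sphereDeriv] at h'
      rwa [radialExt_coe, h'] at h
    simp [this]
  -- Pairing with the position vector kills the tangential part and identifies the multiple of `X`.
  have ha : a = -n := by
    rw [← h1, ← inner_sum, ← hyz, inner_add_right, inner_smul_right, real_inner_self_eq_norm_sq,
      hmin.norm_eq_one]
    have h := inner_fderiv_of_norm_eq_one (hX.differentiableAt two_ne_zero) hnorm w
    rw [radialExt_coe] at h
    change a = a * 1 ^ 2 + ⟪losMap f θ x, sphereDeriv (losMap f θ) x w⟫_ℝ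
    rw [sphereDeriv, h]
    ring
  -- Now pair the first component with `x`: the tangential part drops out again, and each second
  -- derivative contributes `-cos θ * ‖e i‖ ^ 2`.
  have h2 := congrArg (fun z => ⟪(x : Euc (n + 1)), WithLp.fstL 2 ℝ (Euc (n + 1)) (Euc (m + 1)) z⟫_ℝ) hyz
  have hw' : sphereDeriv (losMap f θ) x w = _ := sphereDeriv_losMap (hf.of_le (by norm_num)) hw
  simp only [map_add, map_sum, inner_add_right, inner_sum, ContinuousLinearMap.coe_coe, hw',
    map_smul] at h2
  have h3 : ∀ i, ⟪(x : Euc (n + 1)), WithLp.fstL 2 ℝ (Euc (n + 1)) (Euc (m + 1))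
      (sphereSecondDeriv (losMap f θ) x (e i))⟫_ℝ = Real.cos θ * -‖e i‖ ^ 2 := by
    intro i
    change ⟪(x : Euc (n + 1)), (sphereSecondDeriv (losMap f θ) x (e i)).fst⟫_ℝ = _
    rw [fst_sphereSecondDeriv_losMap hf, inner_smul_right, inner_sphereSecondDeriv_coe x (het i)]
  simp only [h3] at h2
  simp [losMap, inner_smul_right, mem_tangent_iff.1 hw, ha] at h2
  rw [← Finset.mul_sum, mul_comm] at h2
  exact (mul_left_cancel₀ hθ h2).symm

/-- The slope of a minimal Lawson-Osserman cone of constant singular value. -/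
lemma tan_relation {n m p q : ℕ} {f : Sph n → Sph m} {θ lam : ℝ} (hpq : p + q = n)
    (hs : HasSingularValues f p lam) (hL : IsLOM f θ)
    (hf : ∀ x : Sph n, ContDiffAt ℝ 2 (radialExt fun x => (f x : Euc (m + 1))) (x : Euc (n + 1))) :
    q * lam ^ 2 * Real.tan θ ^ 2 = p * lam ^ 2 - n := by
  have hc : 0 < Real.cos θ := Real.cos_pos_of_mem_Ioo
    ⟨by linarith [hL.angle_pos, Real.pi_pos], hL.angle_lt⟩
  have hsin : 0 < Real.sin θ := Real.sin_pos_of_pos_of_lt_pi hL.angle_pos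
    (by linarith [hL.angle_lt, Real.pi_pos])
  have hlam0 := hs.lam_pos
  obtain ⟨x⟩ := nonempty_sph n
  obtain ⟨H, hH, hp, hlam, hzero⟩ := hs.exists_horizontal x
  obtain ⟨u, hu, hu₁, hu₂⟩ := exists_frame hpq hH hp
  have hut := frame_mem_tangent hH hu₁ hu₂
  rw [orthonormal_iff_ite] at hu
  let μ : Fin p ⊕ Fin q → ℝ := Sum.elim (fun _ => lam ^ 2) (fun _ => 0)
  have hμ : ∀ i, 0 ≤ μ i := by
    rintro (i | i)
    · exact sq_nonneg lam
    · exact le_rfl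
  set A := sphereDeriv (fun y => (f y : Euc (m + 1))) x with hA
  have hAu : ∀ i j, ⟪A (u i), A (u j)⟫_ℝ = if i = j then μ i else 0 := by
    rintro (i | i) (j | j)
    · rw [inner_map_map_of_norm_map hlam (hu₁ i) (hu₁ j), hu]
      simp [μ]
    · simp [hzero _ (hu₂ j)]
    · simp [hzero _ (hu₂ i)]
    · simp [hzero _ (hu₂ i), μ]
  let d : Fin p ⊕ Fin q → ℝ := fun i => Real.cos θ ^ 2 + Real.sin θ ^ 2 * μ i
  have hd : ∀ i, 0 < d i := fun i => by have := hμ i; positivity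
  let σ : Fin n ≃ Fin p ⊕ Fin q := (finCongr hpq.symm).trans finSumFinEquiv.symm
  -- The induced metric is diagonal in the frame `u` with entries `d`. Normalizing it turns the
  -- trace identity into `p / (cos² θ + sin² θ * lam²) + q / cos² θ = n`.
  have key := sum_norm_sq_eq_of_isMinimalInSphere hL.minimal hc.ne' (hf x)
    (e := fun i => (√(d (σ i)))⁻¹ • u (σ i)) (fun i => (tangent x).smul_mem _ (hut _)) ?_
  · have h1 : ∑ i, ‖(√(d (σ i)))⁻¹ • u (σ i)‖ ^ 2 = ∑ i, (d i)⁻¹ := by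
      rw [← Equiv.sum_comp σ fun i => (d i)⁻¹]
      refine Finset.sum_congr rfl fun i _ => ?_
      have h2 := hu (σ i) (σ i)
      rw [real_inner_self_eq_norm_sq, if_pos rfl] at h2
      rw [norm_smul, mul_pow, h2, norm_inv, Real.norm_of_nonneg (Real.sqrt_nonneg _), inv_pow,
        Real.sq_sqrt (hd _).le, mul_one]
    rw [h1, Fintype.sum_sum_type] at key
    simp only [d, μ, Sum.elim_inl, Sum.elim_inr, Finset.sum_const, Finset.card_univ,
      Fintype.card_fin, nsmul_eq_mul, mul_zero, add_zero] at key
    have hpq' : (p : ℝ) + q = n := by exact_mod_cast hpq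
    have hX : 0 < Real.cos θ ^ 2 := by positivity
    have hY : 0 < Real.sin θ ^ 2 := by positivity
    have hD : 0 < Real.cos θ ^ 2 + Real.sin θ ^ 2 * lam ^ 2 := by positivity
    have hsc := Real.sin_sq_add_cos_sq θ
    rw [Real.tan_eq_sin_div_cos, div_pow]
    generalize Real.cos θ ^ 2 = X at *
    generalize Real.sin θ ^ 2 = Y at *
    generalize lam ^ 2 = C at *
    rw [← hpq'] at key ⊢
    field_simp at key
    obtain rfl : X = 1 - Y := by linarith
    -- After clearing denominators both sides carry a factor `sin² θ`, nonzero since `θ > 0`.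
    have h2 : q * C = (p + q) * ((1 - Y) * (C - 1)) :=
      mul_left_cancel₀ hY.ne' (by linear_combination key)
    field_simp
    linear_combination h2
  · intro i j
    rw [map_smul, map_smul, inner_smul_left, inner_smul_right,
      sphereDeriv_losMap ((hf x).of_le (by norm_num)) (hut _),
      sphereDeriv_losMap ((hf x).of_le (by norm_num)) (hut _), WithLp.prod_inner_apply]
    simp only [inner_smul_left, inner_smul_right, hu, ← hA, hAu]
    rcases eq_or_ne i j with rfl | hij
    · have h2 := Real.mul_self_sqrt (hd (σ i)).le
      have h4 : Real.cos θ * (Real.cos θ * 1) + Real.sin θ * (Real.sin θ * μ (σ i)) = d (σ i) := by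
        simp only [d]; ring
      simp only [conj_trivial, if_true, h4]
      rw [← mul_assoc, ← mul_inv, h2, inv_mul_cancel₀ (hd _).ne']
    · simp [hij]

end LawsonOsserman

theorem mainTheorem4 (n m p k : ℕ) (f : LawsonOsserman.Sph n → LawsonOsserman.Sph m)
    (θ lam : ℝ) (hf : LawsonOsserman.IsLOMSE f θ p k lam) (hI : LawsonOsserman.IsTypeI n p k) :
    ∃ φ₁ : ℝ, Real.tan θ < φ₁ ∧
      LawsonOsserman.IsMinimizingRayIn n p lam (LawsonOsserman.sector φ₁) (Real.tan θ) := by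
  have hpos := hf.singular_values.mult_pos
  have hlt := hf.singular_values.mult_lt
  have hpq : p + (n - p) = n := by omega
  refine LawsonOsserman.exists_isMinimizingRayIn hpos (Nat.sub_pos_of_lt hlt) hpq
    hf.singular_values.lam_pos (Real.tan_pos_of_pos_of_lt_pi_div_two hf.lom.angle_pos
      hf.lom.angle_lt) hI
    (LawsonOsserman.singularValue_relation hpq hf.singular_values hf.degree)
    (LawsonOsserman.tan_relation hpq hf.singular_values hf.lom fun x => ?_)
  obtain ⟨P, hP⟩ := Classical.axiom_of_choice hf.degree
  exact LawsonOsserman.contDiffAt_radialExt (fun j => (hP j).1) (fun j => (hP j).2.2) x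

end
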